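/- An episodic MDP with $S$ states, $A$ actions and horizon $H$ is given by transition laws $P_h(\cdot\mid s,a)$ and deterministic rewards $r_h(s,a)\in[0,1]$, $h=1,\dots,H$ (both may depend on $h$). For a deterministic policy $\pi=(\pi_h)_{h\le H}$, $\pi_h:\mathcal S\to\mathcal A$, let $V_1^{\pi}(s)=\mathbb E\big[\sum_{h=1}^H r_h(s_h,\pi_h(s_h))\big]$, where $s_1=s$ and $s_{h+1}\sim P_h(\cdot\mid s_h,\pi_h(s_h))$, and let $V_1^*(s)=\sup_\pi V_1^\pi(s)$. An algorithm does not know the MDP; at the beginning of each episode $k=1,2,\dots$ it is given the initial state $s_1^k$ and chooses, possibly at random, a policy $\pi_k$, based on what it observed (policies, visited states, rewards) in the earlier episodes and on $s_1^k$; the episode is then run with $\pi_k$. **Theorem.** There are universal constants $c>0$ and $n_0$ such that for all $S,A,H>n_0$ and all $\epsilon\in(0,\frac8H]$, for every algorithm (which may depend on $S$, $A$, $H$ and $\epsilon$) that is run for an unlimited number of episodes, and for every sequence of initial states $(s_1^k)_{k\ge1}$ fixed in advance, there exists an episodic MDP with $S$ states, $A$ actions and horizon $H$ such that, with probability at least $1/2$,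 the execution history of the algorithm contains at least $$c\cdot\frac{SAH^3}{\epsilon^2}$$ episodes $k$ whose policy $\pi_k$ satisfies $V_1^*(s_1^k)-V_1^{\pi_k}(s_1^k)>\epsilon$. -/

import Mathlib

open scoped ENNReal

namespace EpisodicRL

/-- The total mass of the law of a time-inhomogeneous Markov chain started at `x` is one. -/
theorem sum_chain {α : Type*} [Fintype α] [DecidableEq α] :
    ∀ {n : ℕ} (κ : Fin n → α → PMF α) (x : α),
      ∑ τ : Fin (n + 1) → α,
        (if τ 0 = x then (1 : ℝ≥0∞) else 0) * ∏ h : Fin n, κ h (τ h.castSucc) (τ h.succ) = 1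
  | 0, κ, x => by
      rw [← (Equiv.funUnique (Fin 1) α).symm.sum_comp]
      simp
  | n + 1, κ, x => by
      rw [← (Fin.consEquiv (fun _ : Fin (n + 2) => α)).sum_comp, Fintype.sum_prod_type]
      have key : ∀ σ : Fin (n + 1) → α,
          κ 0 x (σ 0) * ∏ h : Fin n, κ h.succ (σ h.castSucc) (σ h.succ)
            = ∑ y, κ 0 x y * ((if σ 0 = y then (1 : ℝ≥0∞) else 0) *
                ∏ h : Fin n, κ h.succ (σ h.castSucc) (σ h.succ)) := by
        intro σ
        rw [Finset.sum_eq_single (σ 0)]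
        · simp
        · intro y _ hy
          simp [Ne.symm hy]
        · simp
      rw [Finset.sum_eq_single x]
      · have : ∀ σ : Fin (n + 1) → α,
            (if (Fin.consEquiv (fun _ : Fin (n + 2) => α)) (x, σ) 0 = x then (1 : ℝ≥0∞) else 0) *
              ∏ h : Fin (n + 1),
                κ h ((Fin.consEquiv (fun _ : Fin (n + 2) => α)) (x, σ) h.castSucc)
                  ((Fin.consEquiv (fun _ : Fin (n + 2) => α)) (x, σ) h.succ)
              = ∑ y, κ 0 x y * ((if σ 0 = y then (1 : ℝ≥0∞) else 0) *
                ∏ h : Fin n, κ h.succ (σ h.castSucc) (σ h.succ)) := by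
          intro σ
          rw [← key σ, Fin.prod_univ_succ]
          simp [Fin.consEquiv]
        rw [Finset.sum_congr rfl fun σ _ => this σ, Finset.sum_comm]
        simp_rw [← Finset.mul_sum, sum_chain (fun h => κ h.succ), mul_one]
        rw [← tsum_fintype (L := .unconditional _)]
        exact (κ 0 x).tsum_coe
      · intro y _ hy
        simp [Fin.consEquiv, hy]
      · simp

/-- An episodic Markov decision process with state space `Fin S`, action space `Fin A` and
horizon `H`. The steps `1, …, H` are indexed by `Fin H`. Transitions and rewards may
depend on the step; the rewards are deterministic and lie in `[0, 1]`. -/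
structure EpisodicMDP (S A H : ℕ) where
  /-- transition law `P_h(· | s, a)` -/
  P : Fin H → Fin S → Fin A → PMF (Fin S)
  /-- reward `r_h(s, a)` -/
  r : Fin H → Fin S → Fin A → ℝ
  r_nonneg : ∀ h s a, 0 ≤ r h s a
  r_le_one : ∀ h s a, r h s a ≤ 1

/-- A deterministic policy: the action `π_h(s)` for every step `h` and state `s`. -/
abbrev Policy (S A H : ℕ) : Type := Fin H → Fin S → Fin A

/-- The states `s_1, …, s_{H+1}` visited in one episode; step `h : Fin H` starts in state
`τ h.castSucc` and ends in state `τ h.succ`. -/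
abbrev Trajectory (S H : ℕ) : Type := Fin (H + 1) → Fin S

namespace EpisodicMDP

variable {S A H : ℕ} (M : EpisodicMDP S A H)

/-- The law of the states visited in one episode that starts in `s` and follows `π`. -/
noncomputable def trajectoryLaw (π : Policy S A H) (s : Fin S) : PMF (Trajectory S H) :=
  PMF.ofFintype
    (fun τ => (if τ 0 = s then (1 : ℝ≥0∞) else 0) *
      ∏ h : Fin H, M.P h (τ h.castSucc) (π h (τ h.castSucc)) (τ h.succ))
    (sum_chain (fun h x => M.P h x (π h x)) s)

/-- The value `V^π_1(s)`: the expected total reward of an episode that starts in `s` and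
follows `π`. -/
noncomputable def value (π : Policy S A H) (s : Fin S) : ℝ :=
  ∑ τ : Trajectory S H, (M.trajectoryLaw π s τ).toReal *
    ∑ h : Fin H, M.r h (τ h.castSucc) (π h (τ h.castSucc))

/-- The optimal value `V^*_1(s) = sup_π V^π_1(s)`. -/
noncomputable def optValue (s : Fin S) : ℝ := ⨆ π : Policy S A H, M.value π s

end EpisodicMDP

/-- What an algorithm has seen of one past episode: the policy it used, the states it
visited and the rewards it received (the actions are determined by policy and states). -/
structure Observation (S A H : ℕ) where
  policy : Policy S A H
  states : Trajectory S H
  rewards : Fin H → ℝ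

/-- A (possibly randomized) learning algorithm: at the beginning of the episode of index `k`
(counted from `0`) it chooses the policy for this episode at random, with a law that depends on
everything observed in the `k` earlier episodes and on the initial state of the new episode.
The algorithm does not see the MDP in any other way. -/
abbrev Algorithm (S A H : ℕ) : Type :=
  (k : ℕ) → (Fin k → Observation S A H) → Fin S → PMF (Policy S A H)

/-- The outcome of one episode: the policy that was used and the states that were visited. -/
abbrev Outcome (S A H : ℕ) : Type := Policy S A H × Trajectory S H

namespace EpisodicMDP

variable {S A H : ℕ} (M : EpisodicMDP S A H)

/-- The algorithm's observation of an episode with the given outcome. -/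
def observe (o : Outcome S A H) : Observation S A H where
  policy := o.1
  states := o.2
  rewards h := M.r h (o.2 h.castSucc) (o.1 h (o.2 h.castSucc))

/-- The conditional law of the outcome of the episode of index `k`, given the outcomes of the
earlier episodes: the algorithm chooses a policy, then an episode is run with this policy. -/
noncomputable def nextOutcome (alg : Algorithm S A H) (s₁ : ℕ → Fin S) (k : ℕ)
    (past : Fin k → Outcome S A H) : PMF (Outcome S A H) :=
  (alg k (fun i => M.observe (past i)) (s₁ k)).bind fun π =>
    (M.trajectoryLaw π (s₁ k)).map fun τ => (π, τ)

/-- The transition kernel from the outcomes of the episodes of index `0, …, k` to the outcome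
of the episode of index `k + 1`. -/
noncomputable def outcomeKernel (alg : Algorithm S A H) (s₁ : ℕ → Fin S) (k : ℕ) :
    ProbabilityTheory.Kernel (Finset.Iic k → Outcome S A H) (Outcome S A H) :=
  ProbabilityTheory.Kernel.ofFunOfCountable fun past =>
    (M.nextOutcome alg s₁ (k + 1)
      fun i => past ⟨i, Finset.mem_Iic.2 (Nat.lt_succ_iff.1 i.isLt)⟩).toMeasure

instance (alg : Algorithm S A H) (s₁ : ℕ → Fin S) (k : ℕ) :
    ProbabilityTheory.IsMarkovKernel (M.outcomeKernel alg s₁ k) :=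
  ⟨fun _ => PMF.toMeasure.isProbabilityMeasure _⟩

/-- The law of the infinite execution history when `alg` is run on `M`, episode after episode,
with initial state `s₁ k` in the episode of index `k`. -/
noncomputable def executionLaw (alg : Algorithm S A H) (s₁ : ℕ → Fin S) :
    MeasureTheory.Measure (ℕ → Outcome S A H) :=
  ProbabilityTheory.Kernel.trajMeasure (X := fun _ => Outcome S A H)
    (M.nextOutcome alg s₁ 0 Fin.elim0).toMeasure (M.outcomeKernel alg s₁)

/-- The set of (indices of) episodes of a history in which the policy `π_k` satisfies
`V^*_1(s_1^k) - V^{π_k}_1(s_1^k) > ε`. -/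
def suboptimalEpisodes (s₁ : ℕ → Fin S) (ε : ℝ) (ω : ℕ → Outcome S A H) : Set ℕ :=
  {k | ε < M.optValue (s₁ k) - M.value (ω k).1 (s₁ k)}

end EpisodicMDP

end EpisodicRL

/-! The hard MDP hides `S - 2` bandit problems. From every initial state the first step leads to a
uniformly random leaf. In a leaf the policy only decides when to stop waiting and which action to
play then, so each leaf is a bandit with `m (A - 1)` arms `(t, a)`, where `m` is about `H / 2`.
Every arm tosses a fair coin between a good and a bad absorbing state, except one arm `θ s`, whose
coin has bias `δ`. Rewards are paid only after time `m`, so waiting up to time `m` costs nothing and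
the good state is worth `R = H - m - 1`, of order `H`. A policy that plays the distinguished arm in
a fraction `f` of the leaves loses at least `R δ (1 - f)` (`hardMDP_suboptimality`); with `R δ = 4
ε`, a fraction below `3 / 4` forces a loss above `ε`.

Finding the arms takes many episodes. The reference instance has no distinguished arm in the leaf
`x`. Against the instance with arm `p` there, one episode carries relative entropy at most `4 δ² /
(S - 2)` if the policy plays `p`, and none otherwise (`relEnt_hardMDP_le`). A deterministic policy
plays at most one arm per leaf, so over all arms the relative entropies of `T` adaptive episodes sum
to at most `T · 4 δ² / (S - 2)`. By the change of measure `sum_filter_le_relEnt`, the probabilities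
of playing `p` under the instance with arm `p` have a small average over `p` while `T` is below a
small multiple of `S A H / δ²`, which is of order `S A H³ / ε²`.

Averaging over `θ` yields one instance on which the expected fraction is small
(`exists_sum_hitFraction_le`), and Markov's inequality over `2 N` episodes leaves at least `N` bad
ones with probability at least `1 / 2`. All of this concerns finite weighted sums;
`executionLaw_cylinder` connects them with the measure on infinite histories. -/

namespace EpisodicRL

/-! ### Additive functionals of finite Markov chains -/

/-- Summation over tuples, split into the initial part and the last entry. -/
theorem sum_snoc {O R : Type*} [Fintype O] [AddCommMonoid R] {n : ℕ}
    (F : (Fin (n + 1) → O) → R) :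
    ∑ h, F h = ∑ g : Fin n → O, ∑ o, F (Fin.snoc (α := fun _ => O) g o) := by
  rw [← (Fin.snocEquiv (fun _ : Fin (n + 1) => O)).sum_comp, Fintype.sum_prod_type,
    Finset.sum_comm]
  rfl

/-- A supersolution of the Bellman recursion bounds the expectation of an additive functional of
a finite Markov chain. -/
theorem chain_expect_le {α : Type*} [Fintype α] [DecidableEq α] :
    ∀ {n : ℕ} (κ : Fin n → α → α → ℝ) (_ : ∀ i s y, 0 ≤ κ i s y) (_ : ∀ i s, ∑ y, κ i s y = 1)
      (f : Fin n → α → α → ℝ) (U : ℕ → α → ℝ)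
      (_ : ∀ (i : Fin n) s, ∑ y, κ i s y * (f i s y + U (i + 1) y) ≤ U i s) (x : α),
      ∑ τ : Fin (n + 1) → α,
        ((if τ 0 = x then (1 : ℝ) else 0) * ∏ i : Fin n, κ i (τ i.castSucc) (τ i.succ)) *
          (∑ i : Fin n, f i (τ i.castSucc) (τ i.succ) + U n (τ (Fin.last n))) ≤ U 0 x
  | 0, κ, _, _, f, U, _, x => by
      rw [← (Equiv.funUnique (Fin 1) α).symm.sum_comp]
      simp
  | n + 1, κ, h0, h1, f, U, hU, x => by
      -- The last transition is averaged out: the supersolution property at the final step replaces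
      -- the last cost and `U (n + 1)` by `U n`.
      refine le_trans ?_ (chain_expect_le (fun i => κ i.castSucc) (fun i => h0 _) (fun i => h1 _)
        (fun i => f i.castSucc) U (fun i s => hU i.castSucc s) x)
      rw [sum_snoc]
      refine Finset.sum_le_sum fun σ _ => ?_
      have e0 : ∀ y : α, (Fin.snoc (α := fun _ => α) σ y : Fin (n + 2) → α) 0 = σ 0 := by
        intro y
        exact Fin.snoc_castSucc (α := fun _ => α) y σ 0
      have e2 : ∀ (y : α) (i : Fin n),
          (Fin.snoc (α := fun _ => α) σ y : Fin (n + 2) → α) i.castSucc.succ = σ i.succ := by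
        intro y i
        exact Fin.snoc_castSucc (α := fun _ => α) y σ i.succ
      have e3 : ∀ y : α,
          (Fin.snoc (α := fun _ => α) σ y : Fin (n + 2) → α) (Fin.last n).succ = y := by
        intro y
        exact Fin.snoc_last (α := fun _ => α) y σ
      simp only [Fin.prod_univ_castSucc, Fin.sum_univ_castSucc, e0, e2, e3, Fin.snoc_castSucc,
        Fin.snoc_last]
      set w : ℝ := (if σ 0 = x then (1 : ℝ) else 0) *
        ∏ i : Fin n, κ i.castSucc (σ i.castSucc) (σ i.succ) with hw
      have hw0 : 0 ≤ w := mul_nonneg (by split_ifs <;> simp) (Finset.prod_nonneg fun i _ => h0 _ _ _)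
      set c : ℝ := ∑ i : Fin n, f i.castSucc (σ i.castSucc) (σ i.succ)
      have key := hU (Fin.last n) (σ (Fin.last n))
      have h1' := h1 (Fin.last n) (σ (Fin.last n))
      calc _ = w * (c * ∑ y, κ (Fin.last n) (σ (Fin.last n)) y
              + ∑ y, κ (Fin.last n) (σ (Fin.last n)) y *
                (f (Fin.last n) (σ (Fin.last n)) y + U ((Fin.last n : ℕ) + 1) y)) := by
            rw [Finset.mul_sum, ← Finset.sum_add_distrib, Finset.mul_sum]
            refine Finset.sum_congr rfl fun y _ => ?_
            simp only [Fin.val_last, hw]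
            ring
        _ ≤ _ := by
            rw [h1', mul_one]
            refine mul_le_mul_of_nonneg_left ?_ hw0
            simpa using key

/-! ### Relative entropy and change of measure -/

/-- The relative entropy `∑ p log (p / q)` of two weight functions on a finite type. -/
noncomputable def relEnt {ι : Type*} [Fintype ι] (p q : ι → ℝ) : ℝ :=
  ∑ i, p i * Real.log (p i / q i)

/-- A change of measure inequality: an event that is unlikely under `p` is unlikely under every
`q` from which `p` has small relative entropy. -/
theorem sum_filter_le_relEnt {ι : Type*} [Fintype ι] {p q : ι → ℝ} (hp : ∀ i, 0 ≤ p i)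
    (hq : ∀ i, 0 ≤ q i) (hp1 : ∑ i, p i = 1) (hq1 : ∑ i, q i = 1)
    (hpq : ∀ i, p i ≠ 0 → q i ≠ 0) (E : ι → Prop) [DecidablePred E] :
    ∑ i with E i, q i ≤ 2 * (relEnt p q + ∑ i with E i, p i) := by
  have hexp : Real.exp (-1) ≤ 1 / 2 := by
    rw [Real.exp_neg, ← one_div]
    have := Real.add_one_le_exp 1
    gcongr
    linarith
  have key : ∀ i, -(p i * Real.log (p i / q i)) - (if E i then p i else 0)
      ≤ (q i - (1 / 2) * (if E i then q i else 0)) - p i := by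
    intro i
    rcases (hp i).eq_or_lt with h | h
    · rw [← h]
      have := hq i
      split_ifs <;> simp <;> linarith
    · have hqi : 0 < q i := lt_of_le_of_ne (hq i) (hpq i h.ne').symm
      -- The inequality `log z ≤ z - 1` with a free factor `u`: taking `u = exp (-1)` on the event
      -- and `u = 1` off it gives the claim after summation, and `exp (-1) ≤ 1 / 2` accounts for the
      -- factor `2`.
      have hlog : ∀ u : ℝ, 0 < u → p i * Real.log (q i * u / p i) ≤ q i * u - p i := by
        intro u hu
        have := mul_le_mul_of_nonneg_left
          (Real.log_le_sub_one_of_pos (x := q i * u / p i) (by positivity)) h.le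
        rwa [mul_sub, mul_div_cancel₀ _ h.ne', mul_one] at this
      have hneg : Real.log (q i / p i) = - Real.log (p i / q i) := by
        rw [← Real.log_inv, inv_div]
      split_ifs with hE
      · have h2 := hlog (Real.exp (-1)) (Real.exp_pos _)
        rw [mul_div_right_comm, Real.log_mul (by positivity) (by positivity), Real.log_exp,
          hneg] at h2
        have := mul_le_mul_of_nonneg_left hexp hqi.le
        linarith
      · have h2 := hlog 1 one_pos
        rw [mul_one, hneg] at h2
        linarith
  have := Finset.sum_le_sum fun i (_ : i ∈ Finset.univ) => key i
  simp only [Finset.sum_sub_distrib, Finset.sum_neg_distrib, ← Finset.mul_sum, hp1, hq1,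
    ← Finset.sum_filter] at this
  rw [relEnt]
  linarith

/-- The chain rule for the relative entropy. -/
theorem sum_mul_log_mul_div {ι : Type*} [Fintype ι] {a b : ℝ} {k l : ι → ℝ}
    (hab : a ≠ 0 → b ≠ 0) (hkl : ∀ i, k i ≠ 0 → l i ≠ 0) (hk : ∑ i, k i = 1) :
    ∑ i, (a * k i) * Real.log ((a * k i) / (b * l i))
      = a * Real.log (a / b) + a * relEnt k l := by
  rcases eq_or_ne a 0 with rfl | ha
  · simp
  have : ∀ i, (a * k i) * Real.log ((a * k i) / (b * l i))
      = (a * Real.log (a / b)) * k i + a * (k i * Real.log (k i / l i)) := by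
    intro i
    rcases eq_or_ne (k i) 0 with h | h
    · simp [h]
    · rw [mul_div_mul_comm, Real.log_mul (div_ne_zero ha (hab ha)) (div_ne_zero h (hkl i h))]
      ring
  rw [Finset.sum_congr rfl fun i _ => this i, Finset.sum_add_distrib, ← Finset.mul_sum,
    ← Finset.mul_sum, hk, mul_one, relEnt]

/-! ### Finite histories of an adaptive process -/

/-- The weight of a finite history of a process with transition weights `K`. -/
noncomputable def histWeight {O : Type*} (K : (k : ℕ) → (Fin k → O) → O → ℝ) :
    (n : ℕ) → (Fin n → O) → ℝ
  | 0, _ => 1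
  | n + 1, h => histWeight K n (Fin.init h) * K n (Fin.init h) (h (Fin.last n))

section histWeight

variable {O : Type*} {K K' : (k : ℕ) → (Fin k → O) → O → ℝ}

theorem histWeight_snoc (n : ℕ) (g : Fin n → O) (o : O) :
    histWeight K (n + 1) (Fin.snoc (α := fun _ => O) g o) = histWeight K n g * K n g o := by
  rw [histWeight, Fin.init_snoc, Fin.snoc_last]

theorem histWeight_nonneg (h0 : ∀ k g o, 0 ≤ K k g o) : ∀ n g, 0 ≤ histWeight K n g
  | 0, _ => zero_le_one
  | n + 1, _ => mul_nonneg (histWeight_nonneg h0 n _) (h0 _ _ _)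

theorem histWeight_ne_zero (h : ∀ k g o, K k g o ≠ 0 → K' k g o ≠ 0) :
    ∀ n g, histWeight K n g ≠ 0 → histWeight K' n g ≠ 0
  | 0, _, _ => one_ne_zero
  | n + 1, _, hg => mul_ne_zero (histWeight_ne_zero h n _ (left_ne_zero_of_mul hg))
      (h _ _ _ (right_ne_zero_of_mul hg))

variable [Fintype O]

theorem sum_histWeight (h1 : ∀ k g, ∑ o, K k g o = 1) : ∀ n, ∑ g, histWeight K n g = 1
  | 0 => by simp [histWeight]
  | n + 1 => by
      rw [sum_snoc]
      simp_rw [histWeight_snoc, ← Finset.mul_sum, h1, mul_one]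
      exact sum_histWeight h1 n

/-- The relative entropy of the laws of two histories is the accumulated expected relative
entropy of the transitions. -/
theorem relEnt_histWeight (h1 : ∀ k g, ∑ o, K k g o = 1)
    (hKK' : ∀ k g o, K k g o ≠ 0 → K' k g o ≠ 0) (n : ℕ) :
    relEnt (histWeight K n) (histWeight K' n)
      = ∑ k ∈ Finset.range n, ∑ g, histWeight K k g * relEnt (K k g) (K' k g) := by
  induction n with
  | zero => simp [relEnt, histWeight]
  | succ n ih =>
    rw [Finset.sum_range_succ, ← ih, relEnt, sum_snoc]
    simp_rw [histWeight_snoc]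
    rw [Finset.sum_congr rfl fun g _ => sum_mul_log_mul_div
      (histWeight_ne_zero hKK' n g) (hKK' n g) (h1 n g), Finset.sum_add_distrib]
    rfl

end histWeight


/-! ### Values and relative entropy of a single episode -/

theorem sum_toReal_pmf {α : Type*} [Fintype α] (p : PMF α) : ∑ y, (p y).toReal = 1 := by
  rw [← ENNReal.toReal_sum fun y _ => p.apply_ne_top y, ← tsum_fintype (L := .unconditional _),
    p.tsum_coe, ENNReal.toReal_one]

namespace EpisodicMDP

variable {S A H : ℕ} (M M' : EpisodicMDP S A H)

theorem toReal_trajectoryLaw (π : Policy S A H) (s : Fin S) (τ : Trajectory S H) :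
    (M.trajectoryLaw π s τ).toReal = (if τ 0 = s then (1 : ℝ) else 0) *
      ∏ h : Fin H, (M.P h (τ h.castSucc) (π h (τ h.castSucc)) (τ h.succ)).toReal := by
  rw [trajectoryLaw, PMF.ofFintype_apply, ENNReal.toReal_mul, ENNReal.toReal_prod]
  split_ifs <;> simp

/-- A supersolution of the Bellman recursion bounds the expectation of an additive functional of
the trajectory. -/
theorem trajectory_expect_le (π : Policy S A H) (f : Fin H → Fin S → Fin S → ℝ)
    (U : ℕ → Fin S → ℝ) (hUH : ∀ s, 0 ≤ U H s)
    (hU : ∀ (h : Fin H) s,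
      ∑ y, (M.P h s (π h s) y).toReal * (f h s y + U (h + 1) y) ≤ U h s) (s : Fin S) :
    ∑ τ : Trajectory S H, (M.trajectoryLaw π s τ).toReal *
      ∑ h : Fin H, f h (τ h.castSucc) (τ h.succ) ≤ U 0 s := by
  refine le_trans ?_ (chain_expect_le (fun h s y => (M.P h s (π h s) y).toReal)
    (fun _ _ _ => ENNReal.toReal_nonneg) (fun h s => sum_toReal_pmf _) f U hU s)
  refine Finset.sum_le_sum fun τ _ => ?_
  rw [toReal_trajectoryLaw]
  refine mul_le_mul_of_nonneg_left (by linarith [hUH (τ (Fin.last H))]) ?_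
  exact mul_nonneg (by split_ifs <;> simp) (Finset.prod_nonneg fun _ _ => ENNReal.toReal_nonneg)

theorem value_le (π : Policy S A H) (U : ℕ → Fin S → ℝ) (hUH : ∀ s, 0 ≤ U H s)
    (hU : ∀ (h : Fin H) s,
      M.r h s (π h s) + ∑ y, (M.P h s (π h s) y).toReal * U (h + 1) y ≤ U h s) (s : Fin S) :
    M.value π s ≤ U 0 s := by
  refine M.trajectory_expect_le π (fun h s _ => M.r h s (π h s)) U hUH (fun h s => ?_) s
  simp_rw [mul_add, Finset.sum_add_distrib, ← Finset.sum_mul, sum_toReal_pmf, one_mul]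
  exact hU h s

theorem le_value (π : Policy S A H) (U : ℕ → Fin S → ℝ) (hUH : ∀ s, U H s ≤ 0)
    (hU : ∀ (h : Fin H) s,
      U h s ≤ M.r h s (π h s) + ∑ y, (M.P h s (π h s) y).toReal * U (h + 1) y) (s : Fin S) :
    U 0 s ≤ M.value π s := by
  -- A subsolution becomes a supersolution when rewards and `U` change sign.
  have := M.trajectory_expect_le π (fun h s _ => - M.r h s (π h s)) (fun t s => - U t s)
    (fun s => neg_nonneg.2 (hUH s)) (fun h s => ?_) s
  · simp_rw [Finset.sum_neg_distrib, mul_neg, Finset.sum_neg_distrib] at this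
    exact neg_le_neg_iff.1 this
  · simp_rw [mul_add, Finset.sum_add_distrib, ← Finset.sum_mul, sum_toReal_pmf, one_mul, mul_neg,
      Finset.sum_neg_distrib]
    linarith [hU h s]

theorem value_le_optValue (π : Policy S A H) (s : Fin S) : M.value π s ≤ M.optValue s :=
  le_ciSup (Set.finite_range fun π => M.value π s).bddAbove π

theorem trajectoryLaw_ne_zero (hMM' : ∀ h s a y, M.P h s a y ≠ 0 → M'.P h s a y ≠ 0)
    (π : Policy S A H) (s : Fin S) (τ : Trajectory S H) (hτ : M.trajectoryLaw π s τ ≠ 0) :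
    M'.trajectoryLaw π s τ ≠ 0 := by
  rw [trajectoryLaw, PMF.ofFintype_apply] at hτ ⊢
  refine mul_ne_zero (left_ne_zero_of_mul hτ) (Finset.prod_ne_zero_iff.2 fun h hh => ?_)
  exact hMM' _ _ _ _ (Finset.prod_ne_zero_iff.1 (right_ne_zero_of_mul hτ) h hh)

/-- A bound of the relative entropy of the laws of an episode in two MDPs. -/
theorem relEnt_trajectoryLaw_le (hMM' : ∀ h s a y, M.P h s a y ≠ 0 → M'.P h s a y ≠ 0)
    (π : Policy S A H) (U : ℕ → Fin S → ℝ) (hUH : ∀ s, 0 ≤ U H s)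
    (hU : ∀ (h : Fin H) s,
      relEnt (fun y => (M.P h s (π h s) y).toReal) (fun y => (M'.P h s (π h s) y).toReal)
        + ∑ y, (M.P h s (π h s) y).toReal * U (h + 1) y ≤ U h s) (s : Fin S) :
    relEnt (fun τ => (M.trajectoryLaw π s τ).toReal) (fun τ => (M'.trajectoryLaw π s τ).toReal)
      ≤ U 0 s := by
  refine le_trans (le_of_eq ?_) (M.trajectory_expect_le π (fun h s y =>
    Real.log ((M.P h s (π h s) y).toReal / (M'.P h s (π h s) y).toReal)) U hUH (fun h s => ?_) s)
  · refine Finset.sum_congr rfl fun τ _ => ?_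
    rcases eq_or_ne (M.trajectoryLaw π s τ) 0 with h0 | h0
    · simp [h0]
    · congr 1
      beta_reduce
      rw [toReal_trajectoryLaw, toReal_trajectoryLaw]
      rw [trajectoryLaw, PMF.ofFintype_apply] at h0
      have hs : τ 0 = s := by
        by_contra hne
        simp [hne] at h0
      have hP := Finset.prod_ne_zero_iff.1 (right_ne_zero_of_mul h0)
      rw [if_pos hs, one_mul, one_mul, ← Finset.prod_div_distrib, Real.log_prod]
      intro h hh
      refine div_ne_zero ?_ ?_
      · exact ENNReal.toReal_ne_zero.2 ⟨hP h hh, PMF.apply_ne_top _ _⟩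
      · exact ENNReal.toReal_ne_zero.2 ⟨hMM' _ _ _ _ (hP h hh), PMF.apply_ne_top _ _⟩
  · simp_rw [mul_add, Finset.sum_add_distrib]
    exact hU h s

/-! ### Laws of finitely many episodes -/

/-- The conditional law of the next outcome as real weights. -/
noncomputable def outcomeWeight (alg : Algorithm S A H) (s₁ : ℕ → Fin S) (k : ℕ)
    (past : Fin k → Outcome S A H) (o : Outcome S A H) : ℝ :=
  (M.nextOutcome alg s₁ k past o).toReal

theorem nextOutcome_apply (alg : Algorithm S A H) (s₁ : ℕ → Fin S) (k : ℕ)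
    (past : Fin k → Outcome S A H) (o : Outcome S A H) :
    M.nextOutcome alg s₁ k past o
      = alg k (fun i => M.observe (past i)) (s₁ k) o.1 * M.trajectoryLaw o.1 (s₁ k) o.2 := by
  classical
  obtain ⟨π, τ⟩ := o
  rw [nextOutcome, PMF.bind_apply, tsum_eq_single π]
  · rw [PMF.map_apply, tsum_eq_single τ]
    · simp
    · intro τ' h
      simp [Ne.symm h]
  · intro π' h
    rw [PMF.map_apply]
    simp [Ne.symm h]

theorem outcomeWeight_eq (alg : Algorithm S A H) (s₁ : ℕ → Fin S) (k : ℕ)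
    (past : Fin k → Outcome S A H) (o : Outcome S A H) :
    M.outcomeWeight alg s₁ k past o = (alg k (fun i => M.observe (past i)) (s₁ k) o.1).toReal *
      (M.trajectoryLaw o.1 (s₁ k) o.2).toReal := by
  rw [outcomeWeight, nextOutcome_apply, ENNReal.toReal_mul]

theorem outcomeWeight_nonneg (alg : Algorithm S A H) (s₁ : ℕ → Fin S) (k : ℕ)
    (past : Fin k → Outcome S A H) (o : Outcome S A H) : 0 ≤ M.outcomeWeight alg s₁ k past o :=
  ENNReal.toReal_nonneg

theorem sum_outcomeWeight (alg : Algorithm S A H) (s₁ : ℕ → Fin S) (k : ℕ)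
    (past : Fin k → Outcome S A H) : ∑ o, M.outcomeWeight alg s₁ k past o = 1 :=
  sum_toReal_pmf _

variable {M M'}

theorem observe_congr (hr : M.r = M'.r) (o : Outcome S A H) : M.observe o = M'.observe o := by
  rw [observe, observe, hr]

theorem outcomeWeight_ne_zero (hr : M.r = M'.r)
    (hMM' : ∀ h s a y, M.P h s a y ≠ 0 → M'.P h s a y ≠ 0)
    (alg : Algorithm S A H) (s₁ : ℕ → Fin S) (k : ℕ)
    (past : Fin k → Outcome S A H) (o : Outcome S A H)
    (ho : M.outcomeWeight alg s₁ k past o ≠ 0) : M'.outcomeWeight alg s₁ k past o ≠ 0 := by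
  rw [outcomeWeight_eq] at ho ⊢
  simp_rw [observe_congr hr] at ho
  refine mul_ne_zero (left_ne_zero_of_mul ho) ?_
  have := ENNReal.toReal_ne_zero.1 (right_ne_zero_of_mul ho)
  exact ENNReal.toReal_ne_zero.2
    ⟨trajectoryLaw_ne_zero M M' hMM' _ _ _ this.1, PMF.apply_ne_top _ _⟩

/-- With equal rewards both MDPs show the algorithm the same observations, so its choice
probabilities cancel in the likelihood ratio and only the randomness of the episode contributes. -/
theorem relEnt_outcomeWeight (hr : M.r = M'.r)
    (hMM' : ∀ h s a y, M.P h s a y ≠ 0 → M'.P h s a y ≠ 0)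
    (alg : Algorithm S A H) (s₁ : ℕ → Fin S) (k : ℕ) (past : Fin k → Outcome S A H) :
    relEnt (M.outcomeWeight alg s₁ k past) (M'.outcomeWeight alg s₁ k past)
      = ∑ π, (alg k (fun i => M.observe (past i)) (s₁ k) π).toReal *
          relEnt (fun τ => (M.trajectoryLaw π (s₁ k) τ).toReal)
            (fun τ => (M'.trajectoryLaw π (s₁ k) τ).toReal) := by
  rw [relEnt, Fintype.sum_prod_type]
  refine Finset.sum_congr rfl fun π _ => ?_
  simp_rw [outcomeWeight_eq, ← observe_congr hr]
  rw [sum_mul_log_mul_div id (fun τ hτ => ?_) (sum_toReal_pmf _)]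
  · rcases eq_or_ne (alg k (fun i => M.observe (past i)) (s₁ k) π).toReal 0 with h | h
    · simp [h]
    · simp [div_self h]
  · have := ENNReal.toReal_ne_zero.1 hτ
    exact ENNReal.toReal_ne_zero.2
      ⟨trajectoryLaw_ne_zero M M' hMM' _ _ _ this.1, PMF.apply_ne_top _ _⟩

variable (M)

/-- The law of the first `n` outcomes of an execution as real weights. -/
noncomputable def executionWeight (alg : Algorithm S A H) (s₁ : ℕ → Fin S) (n : ℕ) :
    (Fin n → Outcome S A H) → ℝ :=
  histWeight (M.outcomeWeight alg s₁) n

theorem executionWeight_nonneg (alg : Algorithm S A H) (s₁ : ℕ → Fin S) (n : ℕ)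
    (g : Fin n → Outcome S A H) : 0 ≤ M.executionWeight alg s₁ n g :=
  histWeight_nonneg (M.outcomeWeight_nonneg alg s₁) n g

theorem sum_executionWeight (alg : Algorithm S A H) (s₁ : ℕ → Fin S) (n : ℕ) :
    ∑ g, M.executionWeight alg s₁ n g = 1 :=
  sum_histWeight (M.sum_outcomeWeight alg s₁) n

theorem executionWeight_succ (alg : Algorithm S A H) (s₁ : ℕ → Fin S) (n : ℕ)
    (g : Fin (n + 1) → Outcome S A H) :
    M.executionWeight alg s₁ (n + 1) g = M.executionWeight alg s₁ n (Fin.init g) *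
      M.outcomeWeight alg s₁ n (Fin.init g) (g (Fin.last n)) :=
  rfl

theorem executionWeight_zero (alg : Algorithm S A H) (s₁ : ℕ → Fin S)
    (g : Fin 0 → Outcome S A H) : M.executionWeight alg s₁ 0 g = 1 :=
  rfl

end EpisodicMDP

/-! ### From finite histories to the infinite execution law -/

namespace EpisodicMDP
variable {S A H : ℕ} (M : EpisodicMDP S A H)

open MeasureTheory ProbabilityTheory Preorder

theorem executionLaw_cylinder_one (alg : Algorithm S A H) (s₁ : ℕ → Fin S)
    (o : Outcome S A H) :
    M.executionLaw alg s₁ {ω | ω 0 = o} = M.nextOutcome alg s₁ 0 Fin.elim0 o := by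
  have hmap : (M.executionLaw alg s₁).map (frestrictLe 0)
      = (M.nextOutcome alg s₁ 0 Fin.elim0).toMeasure.map
        (MeasurableEquiv.piUnique (fun _ : Finset.Iic 0 => Outcome S A H)).symm := by
    rw [executionLaw, Kernel.trajMeasure, Measure.map_comp _ _ (by fun_prop),
      Kernel.traj_map_frestrictLe, Kernel.partialTraj_self, Measure.id_comp]
  have hset : {ω : ℕ → Outcome S A H | ω 0 = o}
      = frestrictLe (π := fun _ => Outcome S A H) 0 ⁻¹' {fun _ => o} := by
    ext ω
    simp only [Set.mem_ofPred_eq, Set.mem_preimage, Set.mem_singleton_iff, funext_iff]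
    constructor
    · rintro h ⟨i, hi⟩
      have : i = 0 := by simpa using hi
      subst this
      exact h
    · intro h
      exact h ⟨0, by simp⟩
  rw [hset, ← Measure.map_apply (by fun_prop) (MeasurableSet.singleton _), hmap,
    Measure.map_apply (by fun_prop) (MeasurableSet.singleton _),
    ← PMF.toMeasure_apply_singleton _ o (MeasurableSet.singleton o)]
  congr 1
  ext x
  simp only [Set.mem_preimage, Set.mem_singleton_iff]
  constructor
  · intro h
    simpa using congrFun h default
  · rintro rfl
    rfl

theorem executionLaw_cylinder_succ (alg : Algorithm S A H) (s₁ : ℕ → Fin S) (a : ℕ)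
    (g : Fin (a + 1) → Outcome S A H) (o : Outcome S A H) :
    M.executionLaw alg s₁ {ω | (∀ i : Fin (a + 1), ω i = g i) ∧ ω (a + 1) = o}
      = M.executionLaw alg s₁ {ω | ∀ i : Fin (a + 1), ω i = g i}
        * M.nextOutcome alg s₁ (a + 1) g o := by
  set p : Finset.Iic a → Outcome S A H :=
    fun i => g ⟨i, Nat.lt_succ_iff.2 (Finset.mem_Iic.1 i.2)⟩ with hp
  have hpre : ∀ ω : ℕ → Outcome S A H,
      frestrictLe (π := fun _ => Outcome S A H) a ω = p ↔ ∀ i : Fin (a + 1), ω i = g i := by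
    intro ω
    rw [funext_iff]
    constructor
    · intro h i
      exact h ⟨i, Finset.mem_Iic.2 (Nat.lt_succ_iff.1 i.2)⟩
    · intro h i
      exact h ⟨i, Nat.lt_succ_iff.2 (Finset.mem_Iic.1 i.2)⟩
  have h1 : {ω : ℕ → Outcome S A H | ∀ i : Fin (a + 1), ω i = g i}
      = frestrictLe (π := fun _ => Outcome S A H) a ⁻¹' {p} := by
    ext ω
    exact (hpre ω).symm
  have h2 : {ω : ℕ → Outcome S A H | (∀ i : Fin (a + 1), ω i = g i) ∧ ω (a + 1) = o}
      = (fun ω => (frestrictLe (π := fun _ => Outcome S A H) a ω, ω (a + 1))) ⁻¹'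
          ({p} ×ˢ {o}) := by
    ext ω
    simp only [Set.mem_preimage, Set.mem_prod, Set.mem_singleton_iff, hpre]
    rfl
  have hprob : IsProbabilityMeasure (M.executionLaw alg s₁) := by
    rw [executionLaw]
    infer_instance
  rw [h1, h2, ← Measure.map_apply (by fun_prop)
      ((MeasurableSet.singleton _).prod (MeasurableSet.singleton _)),
    ← Measure.map_apply (by fun_prop) (MeasurableSet.singleton _)]
  -- The joint law of the outcomes up to index `a` and the next one is the composition product with
  -- the kernel, which factors on a product of singletons.
  conv_lhs => rw [executionLaw, ← Kernel.map_frestrictLe_trajMeasure_compProd_eq_map_trajMeasure]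
  rw [Measure.compProd_apply_prod (MeasurableSet.singleton _) (MeasurableSet.singleton _),
    lintegral_singleton, mul_comm]
  congr 1
  exact PMF.toMeasure_apply_singleton _ o (MeasurableSet.singleton o)

theorem executionLaw_cylinder (alg : Algorithm S A H) (s₁ : ℕ → Fin S) (n : ℕ)
    (g : Fin (n + 1) → Outcome S A H) :
    M.executionLaw alg s₁ {ω | ∀ i : Fin (n + 1), ω i = g i}
      = ENNReal.ofReal (M.executionWeight alg s₁ (n + 1) g) := by
  induction n with
  | zero =>
    have : {ω : ℕ → Outcome S A H | ∀ i : Fin 1, ω i = g i} = {ω | ω 0 = g 0} := by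
      ext ω
      simp
    rw [this, executionLaw_cylinder_one, executionWeight_succ, executionWeight_zero, one_mul,
      outcomeWeight, ENNReal.ofReal_toReal (PMF.apply_ne_top _ _)]
    congr 2
    funext i
    exact i.elim0
  | succ n ih =>
    have : {ω : ℕ → Outcome S A H | ∀ i : Fin (n + 1 + 1), ω i = g i}
        = {ω | (∀ i : Fin (n + 1), ω i = (Fin.init g : Fin (n + 1) → _) i) ∧
            ω (n + 1) = g (Fin.last _)} := by
      ext ω
      simp [Fin.forall_fin_succ', Fin.init]
    rw [this, executionLaw_cylinder_succ, ih,
      M.executionWeight_succ alg s₁ (n + 1),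
      ENNReal.ofReal_mul (M.executionWeight_nonneg alg s₁ _ _), outcomeWeight,
      ENNReal.ofReal_toReal (PMF.apply_ne_top _ _)]

/-- The probability of an event that is determined by the first `n` episodes. -/
theorem le_executionLaw (alg : Algorithm S A H) (s₁ : ℕ → Fin S) {n : ℕ} (hn : 0 < n)
    (B : (Fin n → Outcome S A H) → Prop) [DecidablePred B] (E : Set (ℕ → Outcome S A H))
    (hE : ∀ ω, B (fun i => ω i) → ω ∈ E) :
    ENNReal.ofReal (∑ g with B g, M.executionWeight alg s₁ n g) ≤ M.executionLaw alg s₁ E := by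
  obtain ⟨n, rfl⟩ := Nat.exists_eq_succ_of_ne_zero hn.ne'
  rw [ENNReal.ofReal_sum_of_nonneg fun g _ => M.executionWeight_nonneg alg s₁ _ g]
  simp_rw [Nat.succ_eq_add_one, ← executionLaw_cylinder]
  rw [← measure_biUnion_finset]
  · refine measure_mono fun ω hω => ?_
    simp only [Finset.mem_filter, Finset.mem_univ, true_and, Set.mem_iUnion,
      Set.mem_ofPred_eq, exists_prop] at hω
    obtain ⟨g, hg, hω⟩ := hω
    refine hE ω ?_
    convert hg using 1
    funext i
    exact hω i
  · intro g _ g' _ hne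
    refine Set.disjoint_left.2 fun ω h h' => hne ?_
    funext i
    rw [← h i, ← h' i]
  · intro g _
    have : {ω : ℕ → Outcome S A H | ∀ i : Fin (n + 1), ω i = g i}
        = ⋂ i : Fin (n + 1), (fun ω : ℕ → Outcome S A H => ω i) ⁻¹' {g i} := by
      ext ω
      simp
    rw [this]
    exact MeasurableSet.iInter fun i => measurable_pi_apply _ (MeasurableSet.singleton _)

end EpisodicMDP
variable {S A H : ℕ}

/-! ### The hard instance -/

/-- Transition weights of the hard instance. State `0` is good and state `1` is bad; both are
absorbing. The other states are leaves. The first step leads to a uniformly random leaf. In a leaf,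
action `0` waits; any other action `a` at time `t` leads to the good state with probability
`1 / 2 + δ` if `(t, a)` is the distinguished pair of the leaf and with probability `1 / 2`
otherwise, and to the bad state else. -/
noncomputable def hardWeight (δ : ℝ) (θ : Fin S → ℕ × ℕ) (t : ℕ) (s : Fin S) (a : ℕ) (y : Fin S) :
    ℝ :=
  if t = 0 then (if 2 ≤ y.val then ((S : ℝ) - 2)⁻¹ else 0)
  else if s.val < 2 ∨ a = 0 then (if y = s then 1 else 0)
  else if y.val = 0 then 1 / 2 + (if θ s = (t, a) then δ else 0)
  else if y.val = 1 then 1 / 2 - (if θ s = (t, a) then δ else 0)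
  else 0

/-- The set of leaves. -/
def leaves (S : ℕ) : Finset (Fin S) := Finset.univ.filter fun y => 2 ≤ y.val

theorem card_leaves (hS : 2 < S) : ((leaves S).card : ℝ) = (S : ℝ) - 2 := by
  have h : (leaves S).card + 2 = S := by
    have h2 : (leaves S).card = (Finset.Ico 2 S).card := by
      rw [← Finset.card_map Fin.valEmbedding]
      congr 1
      ext i
      simp only [leaves, Finset.mem_map, Finset.mem_filter, Finset.mem_univ, true_and,
        Fin.valEmbedding_apply, Finset.mem_Ico]
      constructor
      · rintro ⟨y, hy, rfl⟩
        exact ⟨hy, y.2⟩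
      · rintro ⟨h1, h2⟩
        exact ⟨⟨i, h2⟩, h1, rfl⟩
    rw [h2, Nat.card_Ico]
    omega
  have h' : ((leaves S).card : ℝ) + 2 = S := by exact_mod_cast h
  linarith

/-- Expectations under one transition of the hard instance. -/
theorem sum_hardWeight_mul (hS : 2 < S) (δ : ℝ) (θ : Fin S → ℕ × ℕ) (t : ℕ) (s : Fin S) (a : ℕ)
    (F : Fin S → ℝ) :
    ∑ y, hardWeight δ θ t s a y * F y =
      if t = 0 then ((S : ℝ) - 2)⁻¹ * ∑ y ∈ leaves S, F y
      else if s.val < 2 ∨ a = 0 then F s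
      else (1 / 2 + (if θ s = (t, a) then δ else 0)) * F ⟨0, by omega⟩
        + (1 / 2 - (if θ s = (t, a) then δ else 0)) * F ⟨1, by omega⟩ := by
  unfold hardWeight
  split_ifs with h0 h1 h2
  · simp_rw [ite_mul, zero_mul, ← Finset.sum_filter, ← Finset.mul_sum]
    rfl
  · simp
  all_goals
    rw [← Finset.sum_subset (Finset.subset_univ {(⟨0, by omega⟩ : Fin S), ⟨1, by omega⟩})]
    · rw [Finset.sum_pair (by simp)]
      simp
    · intro y _ hy
      simp only [Finset.mem_insert, Finset.mem_singleton, Fin.ext_iff, not_or] at hy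
      simp [hy.1, hy.2]

theorem sum_hardWeight (hS : 2 < S) (δ : ℝ) (θ : Fin S → ℕ × ℕ) (t : ℕ) (s : Fin S) (a : ℕ) :
    ∑ y, hardWeight δ θ t s a y = 1 := by
  have h := sum_hardWeight_mul hS δ θ t s a fun _ => 1
  simp only [mul_one] at h
  have hS' : (2 : ℝ) < S := by exact_mod_cast hS
  rw [h, Finset.sum_const, nsmul_eq_mul, mul_one, card_leaves hS,
    inv_mul_cancel₀ (by linarith)]
  split_ifs <;> ring

theorem hardWeight_nonneg (hS : 2 < S) {δ : ℝ} (h0 : 0 ≤ δ) (h1 : δ ≤ 1 / 4) (θ : Fin S → ℕ × ℕ)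
    (t : ℕ) (s : Fin S) (a : ℕ) (y : Fin S) : 0 ≤ hardWeight δ θ t s a y := by
  have hS' : (2 : ℝ) < S := by exact_mod_cast hS
  have : 0 ≤ ((S : ℝ) - 2)⁻¹ := inv_nonneg.2 (by linarith)
  unfold hardWeight
  split_ifs <;> linarith

/-- The support does not depend on the distinguished pairs, since `δ < 1 / 2` keeps both coin
probabilities positive. This makes all relative entropies below meaningful. -/
theorem hardWeight_ne_zero {δ : ℝ} (h0 : 0 ≤ δ) (h1 : δ ≤ 1 / 4)
    (θ θ' : Fin S → ℕ × ℕ) (t : ℕ) (s : Fin S) (a : ℕ) (y : Fin S)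
    (h : hardWeight δ θ t s a y ≠ 0) : hardWeight δ θ' t s a y ≠ 0 := by
  revert h
  unfold hardWeight
  split_ifs <;> intro h <;> first | exact h | (exact absurd rfl h) | (apply ne_of_gt; linarith)

/-- The hard instance with distinguished pairs `θ` and advantage `δ`. The good state gives reward
`1` after time `m`. -/
noncomputable def hardMDP (A H : ℕ) (hS : 2 < S) {δ : ℝ} (h0 : 0 ≤ δ) (h1 : δ ≤ 1 / 4) (m : ℕ)
    (θ : Fin S → ℕ × ℕ) : EpisodicMDP S A H where
  P t s a := PMF.ofFintype (fun y => ENNReal.ofReal (hardWeight δ θ t s a y)) (by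
    rw [← ENNReal.ofReal_sum_of_nonneg fun y _ => hardWeight_nonneg hS h0 h1 θ t s a y,
      sum_hardWeight hS, ENNReal.ofReal_one])
  r t s _ := if s.val = 0 ∧ m < t.val then 1 else 0
  r_nonneg t s a := by split_ifs <;> simp
  r_le_one t s a := by split_ifs <;> simp

/-- From time `t` on, the policy `π` waits in the leaf `s` until time `p.1` and then plays
`p.2`. -/
def Policy.Hits (π : Policy S A H) (t : ℕ) (s : Fin S) (p : ℕ × ℕ) : Prop :=
  t ≤ p.1 ∧ (∀ i : Fin H, t ≤ i.val → i.val < p.1 → (π i s).val = 0) ∧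
    ∃ i : Fin H, i.val = p.1 ∧ (π i s).val = p.2

/-- Both pairs describe the first non-waiting action from time `t` on. A pair with action `0` would
not end the waiting, hence the two conditions. -/
theorem Policy.Hits.unique {π : Policy S A H} {t : ℕ} {s : Fin S} {p q : ℕ × ℕ}
    (hp : π.Hits t s p) (hq : π.Hits t s q) (hp0 : p.2 ≠ 0) (hq0 : q.2 ≠ 0) : p = q := by
  obtain ⟨hp1, hp2, i, hi, hi'⟩ := hp
  obtain ⟨hq1, hq2, j, hj, hj'⟩ := hq
  have h1 : ¬ p.1 < q.1 := fun h => hp0 (by rw [← hi', hq2 i (by omega) (by omega)])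
  have h2 : ¬ q.1 < p.1 := fun h => hq0 (by rw [← hj', hp2 j (by omega) (by omega)])
  have h3 : i = j := Fin.ext (by omega)
  subst h3
  exact Prod.ext (by omega) (by omega)

theorem Policy.Hits.of_succ {π : Policy S A H} {t : Fin H} {s : Fin S} {p : ℕ × ℕ}
    (hp : π.Hits (t + 1) s p) (h0 : (π t s).val = 0) : π.Hits t s p := by
  obtain ⟨h1, h2, h3⟩ := hp
  refine ⟨by omega, fun i hi hi' => ?_, h3⟩
  rcases hi.eq_or_lt with h | h
  · rwa [← Fin.ext h]
  · exact h2 i h hi'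

theorem Policy.hits_self (π : Policy S A H) (t : Fin H) (s : Fin S) :
    π.Hits t s (t, (π t s).val) :=
  ⟨le_rfl, fun i h h' => absurd h' (by simpa using h), t, rfl, rfl⟩

/-! ### Values in the hard instance -/

section hardMDP

variable {hS : 2 < S} {δ : ℝ} {h0 : 0 ≤ δ} {h1 : δ ≤ 1 / 4} {m : ℕ}

theorem toReal_hardMDP_P (θ : Fin S → ℕ × ℕ) (t : Fin H) (s : Fin S) (a : Fin A) (y : Fin S) :
    ((hardMDP A H hS h0 h1 m θ).P t s a y).toReal = hardWeight δ θ t s a y :=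
  ENNReal.toReal_ofReal (hardWeight_nonneg hS h0 h1 _ _ _ _ _)

theorem hardMDP_P_ne_zero (θ θ' : Fin S → ℕ × ℕ) (t : Fin H) (s : Fin S) (a : Fin A) (y : Fin S)
    (h : (hardMDP A H hS h0 h1 m θ).P t s a y ≠ 0) :
    (hardMDP A H hS h0 h1 m θ').P t s a y ≠ 0 := by
  have h' : hardWeight δ θ t s a y ≠ 0 := by
    rw [← toReal_hardMDP_P (hS := hS) (h0 := h0) (h1 := h1) (m := m)]
    exact ENNReal.toReal_ne_zero.2 ⟨h, PMF.apply_ne_top _ _⟩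
  have h2 := hardWeight_ne_zero h0 h1 θ θ' t s a y h'
  rw [← toReal_hardMDP_P (hS := hS) (h0 := h0) (h1 := h1) (m := m)] at h2
  exact (ENNReal.toReal_ne_zero.1 h2).1

theorem hardMDP_r_congr (θ θ' : Fin S → ℕ × ℕ) :
    (hardMDP A H hS h0 h1 m θ).r = (hardMDP A H hS h0 h1 m θ').r :=
  rfl

open Classical in
/-- The fraction of the leaves in which the policy plays the distinguished pair. -/
noncomputable def hitFraction (π : Policy S A H) (θ : Fin S → ℕ × ℕ) : ℝ :=
  ((S : ℝ) - 2)⁻¹ * ∑ s ∈ leaves S, if π.Hits 1 s (θ s) then 1 else 0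

open Classical in
theorem hardMDP_value_le (hm : m < H) (θ : Fin S → ℕ × ℕ) (π : Policy S A H)
    (s₁ : Fin S) :
    (hardMDP A H hS h0 h1 m θ).value π s₁
      ≤ ((H : ℝ) - m - 1) * (1 / 2 + δ * hitFraction π θ) := by
  have hmH : (m : ℝ) + 1 ≤ H := by exact_mod_cast hm
  -- `G t` is the reward still to be collected in the good state from time `t` on. `U` bounds the
  -- value of a leaf by that of an exit at once, with the biased coin exactly when the policy is
  -- still going to play the distinguished pair.
  set G : ℕ → ℝ := fun t => min ((H : ℝ) - m - 1) ((H : ℝ) - t) with hG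
  set U : ℕ → Fin S → ℝ := fun t s =>
    if t = 0 then ((H : ℝ) - m - 1) * (1 / 2 + δ * hitFraction π θ)
    else if s.val = 0 then G t
    else if s.val = 1 then 0
    else G t * (1 / 2 + δ * (if π.Hits t s (θ s) then 1 else 0)) with hU
  have hG0 : ∀ t, t ≤ H → 0 ≤ G t := by
    intro t ht
    have : (t : ℝ) ≤ H := by exact_mod_cast ht
    exact le_min (by linarith) (by linarith)
  have hGs : ∀ t, G (t + 1) ≤ G t := by
    intro t
    refine min_le_min le_rfl ?_
    push_cast
    linarith
  have hH : H ≠ 0 := by omega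
  have := (hardMDP A H hS h0 h1 m θ).value_le π U (fun s => ?_) (fun t s => ?_) s₁
  · simpa [hU] using this
  · have := hG0 H le_rfl
    simp only [hU, hH, if_false]
    split_ifs <;> nlinarith
  · simp_rw [toReal_hardMDP_P]
    rw [sum_hardWeight_mul hS]
    have hGt := hG0 t t.2.le
    have hGt1 := hG0 (t + 1) t.2
    have hGst := hGs t
    change (if s.val = 0 ∧ m < t.val then (1 : ℝ) else 0) + _ ≤ _
    rcases eq_or_ne t.val 0 with ht | ht
    · rw [if_neg (by omega), if_pos ht, ht]
      have hG1 : G 1 ≤ (H : ℝ) - m - 1 := min_le_left _ _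
      have hS' : (2 : ℝ) < S := by exact_mod_cast hS
      have hsum : ∑ y ∈ leaves S, U (0 + 1) y ≤ ∑ y ∈ leaves S, ((H : ℝ) - m - 1) *
          (1 / 2 + δ * (if π.Hits 1 y (θ y) then 1 else 0)) := by
        refine Finset.sum_le_sum fun y hy => ?_
        have hy2 : 2 ≤ y.val := by simpa [leaves] using hy
        simp only [hU, zero_add, one_ne_zero, if_false, show y.val ≠ 0 by omega,
          show y.val ≠ 1 by omega]
        refine mul_le_mul_of_nonneg_right hG1 ?_
        split_ifs <;> linarith
      have hinv : 0 ≤ ((S : ℝ) - 2)⁻¹ := inv_nonneg.2 (by linarith)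
      rw [zero_add]
      refine (mul_le_mul_of_nonneg_left hsum hinv).trans (le_of_eq ?_)
      simp only [hU, if_true, hitFraction]
      rw [← Finset.mul_sum, Finset.sum_add_distrib, ← Finset.mul_sum, Finset.sum_const,
        nsmul_eq_mul, card_leaves hS]
      field_simp [show (S : ℝ) - 2 ≠ 0 by linarith]
    · rw [if_neg ht]
      rcases eq_or_ne s.val 0 with hs | hs
      · simp only [hU, hs, ht, Nat.add_eq_zero_iff, one_ne_zero, and_false, if_false, if_true,
          true_and, Nat.ofNat_pos, true_or]
        split_ifs with hmt
        · have : (m : ℝ) + 1 ≤ t.val := by exact_mod_cast hmt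
          have e1 : G t = (H : ℝ) - t := min_eq_right (by linarith)
          have e2 : G (t + 1) ≤ (H : ℝ) - (t + 1 : ℕ) := min_le_right _ _
          push_cast at e2
          linarith
        · linarith
      · rw [if_neg (by omega)]
        rcases eq_or_ne s.val 1 with hs1 | hs1
        · simp [hU, hs1, ht]
        · split_ifs with ha hθ
          · have ha' : (π t s).val = 0 := by omega
            simp only [hU, hs, hs1, ht, Nat.add_eq_zero_iff, one_ne_zero, and_false, if_false,
              zero_add]
            -- Waiting preserves the prospect of a hit: a hit from `t + 1` on is also a hit from `t`
            -- on.
            split_ifs with c1 c2 c2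
            · nlinarith
            · exact absurd (c1.of_succ ha') c2
            · nlinarith
            · nlinarith
          · have hit : π.Hits t s (θ s) := hθ ▸ π.hits_self t s
            simp only [hU, hs, hs1, ht, Nat.add_eq_zero_iff, one_ne_zero, and_false, if_false,
              if_true, hit]
            nlinarith
          · simp only [hU, hs, hs1, ht, Nat.add_eq_zero_iff, one_ne_zero, and_false, if_false,
              if_true]
            split_ifs <;> nlinarith

theorem le_hardMDP_optValue (hm : m < H) (θ : Fin S → ℕ × ℕ)
    (hθ : ∀ s, 1 ≤ (θ s).1 ∧ (θ s).1 ≤ m ∧ 1 ≤ (θ s).2 ∧ (θ s).2 < A) (s₁ : Fin S) :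
    ((H : ℝ) - m - 1) * (1 / 2 + δ) ≤ (hardMDP A H hS h0 h1 m θ).optValue s₁ := by
  have hmH : (m : ℝ) + 1 ≤ H := by exact_mod_cast hm
  have hA : 0 < A := by have := hθ s₁; omega
  -- This policy waits in each leaf except at the distinguished time, when it plays the
  -- distinguished action.
  set π : Policy S A H := fun t s =>
    if t.val = (θ s).1 then ⟨(θ s).2, (hθ s).2.2.2⟩ else ⟨0, hA⟩ with hπ
  refine le_trans ?_ (EpisodicMDP.value_le_optValue _ π s₁)
  set G : ℕ → ℝ := fun t => min ((H : ℝ) - m - 1) ((H : ℝ) - t) with hG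
  -- Past its distinguished time a leaf gets the trivial lower bound `0`; this loses nothing, since
  -- the policy has left by then.
  set U : ℕ → Fin S → ℝ := fun t s =>
    if t = 0 then ((H : ℝ) - m - 1) * (1 / 2 + δ)
    else if s.val = 0 then G t
    else if s.val = 1 then 0
    else if t ≤ (θ s).1 then ((H : ℝ) - m - 1) * (1 / 2 + δ) else 0 with hU
  have hH : H ≠ 0 := by omega
  have hG0 : ∀ t, t ≤ H → 0 ≤ G t := by
    intro t ht
    have : (t : ℝ) ≤ H := by exact_mod_cast ht
    exact le_min (by linarith) (by linarith)
  have hG1 : ∀ t, t ≤ m → G (t + 1) = (H : ℝ) - m - 1 := by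
    intro t ht
    have : (t : ℝ) ≤ m := by exact_mod_cast ht
    refine min_eq_left ?_
    push_cast
    linarith
  have := (hardMDP A H hS h0 h1 m θ).le_value π U (fun s => ?_) (fun t s => ?_) s₁
  · simpa [hU] using this
  · have h3 : G H ≤ 0 := (min_le_right _ _).trans (by simp)
    have h2 := (hθ s).2.1
    simp only [hU, hH, if_false, show ¬ H ≤ (θ s).1 by omega]
    split_ifs <;> linarith
  · simp_rw [toReal_hardMDP_P]
    rw [sum_hardWeight_mul hS]
    have hGt1 := hG0 (t + 1) t.2
    change _ ≤ (if s.val = 0 ∧ m < t.val then (1 : ℝ) else 0) + _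
    rcases eq_or_ne t.val 0 with ht | ht
    · rw [if_neg (by omega), if_pos ht, ht]
      have hS' : (2 : ℝ) < S := by exact_mod_cast hS
      have hsum : ∑ y ∈ leaves S, U (0 + 1) y
          = ∑ y ∈ leaves S, ((H : ℝ) - m - 1) * (1 / 2 + δ) := by
        refine Finset.sum_congr rfl fun y hy => ?_
        have hy2 : 2 ≤ y.val := by simpa [leaves] using hy
        simp only [hU, zero_add, one_ne_zero, if_false, show y.val ≠ 0 by omega,
          show y.val ≠ 1 by omega, (hθ y).1, if_true]
      rw [zero_add, hsum, Finset.sum_const, nsmul_eq_mul, card_leaves hS,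
        inv_mul_cancel_left₀ (by linarith)]
      simp [hU]
    · rw [if_neg ht]
      rcases eq_or_ne s.val 0 with hs | hs
      · simp only [hU, hs, ht, Nat.add_eq_zero_iff, one_ne_zero, and_false, if_false, if_true,
          true_and, Nat.ofNat_pos, true_or]
        split_ifs with hmt
        · have e1 : G t ≤ (H : ℝ) - t := min_le_right _ _
          have : (m : ℝ) + 1 ≤ t.val := by exact_mod_cast hmt
          have e2 : G (t + 1) = (H : ℝ) - (t + 1 : ℕ) := min_eq_right (by push_cast; linarith)
          push_cast at e2
          linarith
        · rw [hG1 t (by omega), zero_add]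
          exact min_le_left _ _
      · rw [if_neg (by omega), zero_add]
        rcases eq_or_ne s.val 1 with hs1 | hs1
        · simp [hU, hs1, ht]
        · have hR : 0 ≤ ((H : ℝ) - m - 1) * (1 / 2 + δ) :=
            mul_nonneg (by linarith) (by linarith)
          rcases eq_or_ne t.val (θ s).1 with htθ | htθ
          · have ha : (π t s).val = (θ s).2 := by simp [hπ, htθ]
            have := hθ s
            have hθe : θ s = (t.val, (θ s).2) := by rw [htθ]
            rw [ha, if_neg (by omega), ← hθe, if_pos rfl]
            simp only [hU, hs, hs1, ht, Nat.add_eq_zero_iff, one_ne_zero, and_false, if_false,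
              if_true, htθ.le, hG1 t (by omega)]
            linarith
          · have ha : (π t s).val = 0 := by simp [hπ, htθ]
            rw [ha, if_pos (Or.inr rfl)]
            simp only [hU, hs, hs1, ht, Nat.add_eq_zero_iff, one_ne_zero, and_false, if_false]
            split_ifs
            · exact le_rfl
            · omega
            · exact hR
            · exact le_rfl

theorem hardMDP_suboptimality (hm : m < H) (θ : Fin S → ℕ × ℕ)
    (hθ : ∀ s, 1 ≤ (θ s).1 ∧ (θ s).1 ≤ m ∧ 1 ≤ (θ s).2 ∧ (θ s).2 < A) (π : Policy S A H)
    (s₁ : Fin S) :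
    ((H : ℝ) - m - 1) * δ * (1 - hitFraction π θ)
      ≤ (hardMDP A H hS h0 h1 m θ).optValue s₁ - (hardMDP A H hS h0 h1 m θ).value π s₁ := by
  have e1 := hardMDP_value_le (hS := hS) (h0 := h0) (h1 := h1) hm θ π s₁
  have e2 := le_hardMDP_optValue (hS := hS) (h0 := h0) (h1 := h1) hm θ hθ s₁
  linarith

/-! ### Information gained in one episode -/

/-- The left side is the relative entropy of a fair coin with respect to a coin of bias `δ`; it is
quadratic because the first-order terms cancel in the product `(1 / 2 + δ) (1 / 2 - δ)`. -/
theorem log_coin_le (h0 : 0 ≤ δ) (h1 : δ ≤ 1 / 4) :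
    (1 / 2 : ℝ) * Real.log (1 / 2 / (1 / 2 + δ)) + 1 / 2 * Real.log (1 / 2 / (1 / 2 - δ))
      ≤ 4 * δ ^ 2 := by
  rw [← mul_add, ← Real.log_mul (by positivity)
    (div_ne_zero (by norm_num) (by linarith : (1 / 2 - δ : ℝ) ≠ 0 )), div_mul_div_comm]
  have hden : 0 < (1 / 2 + δ) * (1 / 2 - δ) := mul_pos (by linarith) (by linarith)
  have := Real.log_le_sub_one_of_pos (x := 1 / 2 * (1 / 2) / ((1 / 2 + δ) * (1 / 2 - δ)))
    (by positivity)
  have h3 : 1 / 2 * (1 / 2) / ((1 / 2 + δ) * (1 / 2 - δ)) ≤ 1 + 8 * δ ^ 2 := by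
    rw [div_le_iff₀ hden]
    nlinarith [sq_nonneg δ, mul_nonneg (sq_nonneg δ) (by nlinarith : 0 ≤ 1 - 8 * δ ^ 2)]
  linarith

open Classical in
/-- Moving the distinguished pair of one leaf changes the law of an episode only if the policy
plays that pair. -/
theorem relEnt_hardMDP_le (hH : 0 < H) (θ : Fin S → ℕ × ℕ) (x : Fin S) (hx : x ∈ leaves S)
    (p : ℕ × ℕ) (π : Policy S A H) (s₁ : Fin S) :
    relEnt (fun τ => ((hardMDP A H hS h0 h1 m (Function.update θ x (0, 0))).trajectoryLaw
          π s₁ τ).toReal)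
        (fun τ => ((hardMDP A H hS h0 h1 m (Function.update θ x p)).trajectoryLaw π s₁ τ).toReal)
      ≤ ((S : ℝ) - 2)⁻¹ * (4 * δ ^ 2) * (if π.Hits 1 x p then 1 else 0) := by
  have hx2 : 2 ≤ x.val := by simpa [leaves] using hx
  have hS' : (2 : ℝ) < S := by exact_mod_cast hS
  set D : ℝ := 4 * δ ^ 2 with hD
  have hD0 : 0 ≤ D := by positivity
  -- The only information still to come is one biased coin, tossed in leaf `x` if the policy is
  -- going to play `p` there. At time `0` this is weighted by the probability of reaching `x`.
  set U : ℕ → Fin S → ℝ := fun t s =>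
    if t = 0 then ((S : ℝ) - 2)⁻¹ * D * (if π.Hits 1 x p then 1 else 0)
    else if s = x ∧ π.Hits t x p then D else 0 with hU
  have hU1 : ∀ t y, 0 ≤ U (t + 1) y := by
    intro t y
    simp only [hU, Nat.add_eq_zero_iff, one_ne_zero, and_false, if_false]
    split_ifs <;> linarith
  have := EpisodicMDP.relEnt_trajectoryLaw_le
    (hardMDP A H hS h0 h1 m (Function.update θ x (0, 0)))
    (hardMDP A H hS h0 h1 m (Function.update θ x p)) (hardMDP_P_ne_zero _ _) π U
    (fun s => ?_) (fun t s => ?_) s₁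
  · simpa [hU] using this
  · obtain ⟨n, rfl⟩ := Nat.exists_eq_succ_of_ne_zero hH.ne'
    exact hU1 n s
  · simp_rw [toReal_hardMDP_P, relEnt]
    rw [sum_hardWeight_mul hS, sum_hardWeight_mul hS]
    have hlog : ∀ u : ℝ, Real.log (u / u) = 0 := by
      intro u
      rcases eq_or_ne u 0 with h | h <;> simp [h]
    rcases eq_or_ne t.val 0 with ht | ht
    · have e : ∀ y, hardWeight δ (Function.update θ x (0, 0)) t s (π t s) y
          = hardWeight δ (Function.update θ x p) t s (π t s) y := by
        intro y
        rw [hardWeight, hardWeight, if_pos ht, if_pos ht]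
      simp_rw [if_pos ht, e, hlog]
      rw [Finset.sum_const_zero, mul_zero, zero_add, ht,
        Finset.sum_eq_single_of_mem x hx (fun y _ hy => by simp [hU, hy])]
      simp only [hU, zero_add, one_ne_zero, if_false, if_true, true_and]
      split_ifs <;> simp
    · rw [if_neg ht, if_neg ht]
      by_cases hs : s.val < 2 ∨ (π t s).val = 0
      · have e : ∀ y, hardWeight δ (Function.update θ x (0, 0)) t s (π t s) y
            = hardWeight δ (Function.update θ x p) t s (π t s) y := by
          intro y
          rw [hardWeight, hardWeight, if_neg ht, if_neg ht, if_pos hs, if_pos hs]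
        simp_rw [if_pos hs, e, hlog]
        rw [zero_add]
        simp only [hU, ht, Nat.add_eq_zero_iff, one_ne_zero, and_false, if_false]
        split_ifs with c1 c2 c2
        · exact le_rfl
        · obtain ⟨rfl, hit⟩ := c1
          exact absurd ⟨rfl, hit.of_succ (by omega)⟩ c2
        · exact hD0
        · exact le_rfl
      · rw [if_neg hs, if_neg hs]
        have z0 : U (t + 1) ⟨0, by omega⟩ = 0 := by
          have : (⟨0, by omega⟩ : Fin S) ≠ x := fun h => by simp [← h] at hx2
          simp [hU, this]
        have z1 : U (t + 1) ⟨1, by omega⟩ = 0 := by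
          have : (⟨1, by omega⟩ : Fin S) ≠ x := fun h => by simp [← h] at hx2
          simp [hU, this]
        rw [z0, z1, mul_zero, mul_zero, add_zero, add_zero]
        by_cases hsx : s = x ∧ p = (t.val, (π t s).val)
        · obtain ⟨rfl, hp⟩ := hsx
          -- The pair `(0, 0)` encodes the absence of a distinguished pair: no pair played in a leaf
          -- has time `0`.
          have n0 : ¬ ((0, 0) : ℕ × ℕ) = p := by
            simp [hp, Ne.symm ht]
          have hit : π.Hits t s p := hp ▸ π.hits_self t s
          simp only [hardWeight, ht, hs, Function.update_self, n0, ← hp, if_false, if_true, hU,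
            hit, and_self, one_ne_zero, add_zero, sub_zero]
          exact log_coin_le h0 h1
        · have e : ∀ y, hardWeight δ (Function.update θ x (0, 0)) t s (π t s) y
              = hardWeight δ (Function.update θ x p) t s (π t s) y := by
            intro y
            have : (Function.update θ x (0, 0) s = (t.val, (π t s).val)) ↔
                (Function.update θ x p s = (t.val, (π t s).val)) := by
              rcases eq_or_ne s x with rfl | hne
              · rw [Function.update_self, Function.update_self]
                constructor
                · intro h
                  simp only [Prod.mk.injEq] at h
                  omega
                · intro h
                  exact absurd ⟨rfl, h⟩ hsx
              · rw [Function.update_of_ne hne, Function.update_of_ne hne]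
            simp only [hardWeight, this]
          simp_rw [e, hlog, mul_zero, add_zero]
          simp only [hU, ht, if_false]
          split_ifs <;> linarith

end hardMDP



/-! ### Averaging over the hard instances -/

/-- Resampling one coordinate of a uniformly distributed family. -/
theorem sum_piFinset_update {X B : Type*} [Fintype X] [DecidableEq X]
    (arms : Finset B) (x : X) (F : (X → B) → ℝ) :
    ∑ θ ∈ Fintype.piFinset fun _ : X => arms, ∑ p ∈ arms, F (Function.update θ x p)
      = arms.card * ∑ θ ∈ Fintype.piFinset fun _ : X => arms, F θ := by
  rw [← Finset.sum_product', ← nsmul_eq_mul, ← Finset.sum_const, Finset.sum_comm,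
    ← Finset.sum_product']
  -- Exchanging the resampled value with the old coordinate is an involution.
  refine Finset.sum_nbij' (fun a => (Function.update a.1 x a.2, a.1 x))
    (fun a => (Function.update a.1 x a.2, a.1 x)) ?_ ?_ ?_ ?_ ?_
  · rintro ⟨θ, p⟩ h
    simp only [Finset.mem_product, Fintype.mem_piFinset] at h ⊢
    refine ⟨fun i => ?_, h.1 x⟩
    rcases eq_or_ne i x with rfl | hi
    · simpa using h.2
    · simpa [hi] using h.1 i
  · rintro ⟨θ, p⟩ h
    simp only [Finset.mem_product, Fintype.mem_piFinset] at h ⊢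
    refine ⟨fun i => ?_, h.1 x⟩
    rcases eq_or_ne i x with rfl | hi
    · simpa using h.2
    · simpa [hi] using h.1 i
  · rintro ⟨θ, p⟩ _
    simp
  · rintro ⟨θ, p⟩ _
    simp
  · rintro ⟨θ, p⟩ _
    rfl

section lowerBound

variable {hS : 2 < S} {δ : ℝ} {h0 : 0 ≤ δ} {h1 : δ ≤ 1 / 4} {m : ℕ}

open Classical in
theorem sum_hits_le_one (π : Policy S A H) (x : Fin S) (arms : Finset (ℕ × ℕ))
    (harms : ∀ p ∈ arms, p.2 ≠ 0) :
    ∑ p ∈ arms, (if π.Hits 1 x p then (1 : ℝ) else 0) ≤ 1 := by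
  rw [← Finset.sum_filter, Finset.sum_const, nsmul_eq_mul, mul_one]
  have : (arms.filter fun p => π.Hits 1 x p).card ≤ 1 := by
    refine Finset.card_le_one.2 fun p hp q hq => ?_
    rw [Finset.mem_filter] at hp hq
    exact hp.2.unique hq.2 (harms p hp.1) (harms q hq.1)
  exact_mod_cast this

open Classical in
/-- The accumulated relative entropies, summed over the possible distinguished pairs of a leaf. -/
theorem sum_relEnt_executionWeight_le (hH : 0 < H) (alg : Algorithm S A H) (s₁ : ℕ → Fin S)
    (θ : Fin S → ℕ × ℕ) (x : Fin S) (hx : x ∈ leaves S) (arms : Finset (ℕ × ℕ))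
    (harms : ∀ p ∈ arms, p.2 ≠ 0) (T : ℕ) :
    ∑ p ∈ arms, relEnt
        ((hardMDP A H hS h0 h1 m (Function.update θ x (0, 0))).executionWeight alg s₁ T)
        ((hardMDP A H hS h0 h1 m (Function.update θ x p)).executionWeight alg s₁ T)
      ≤ T * (((S : ℝ) - 2)⁻¹ * (4 * δ ^ 2)) := by
  have hS' : (2 : ℝ) < S := by exact_mod_cast hS
  set C : ℝ := ((S : ℝ) - 2)⁻¹ * (4 * δ ^ 2) with hC
  have hC0 : 0 ≤ C := mul_nonneg (inv_nonneg.2 (by linarith)) (by positivity)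
  set M := hardMDP A H hS h0 h1 m (Function.update θ x (0, 0)) with hM
  have step : ∀ p ∈ arms, relEnt (M.executionWeight alg s₁ T)
      ((hardMDP A H hS h0 h1 m (Function.update θ x p)).executionWeight alg s₁ T)
      ≤ ∑ k ∈ Finset.range T, ∑ g, M.executionWeight alg s₁ k g *
          ∑ π, (alg k (fun i => M.observe (g i)) (s₁ k) π).toReal *
            (C * if π.Hits 1 x p then 1 else 0) := by
    intro p _
    rw [EpisodicMDP.executionWeight, EpisodicMDP.executionWeight,
      relEnt_histWeight (M.sum_outcomeWeight alg s₁)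
        (EpisodicMDP.outcomeWeight_ne_zero (hardMDP_r_congr _ _) (hardMDP_P_ne_zero _ _) alg s₁)]
    refine Finset.sum_le_sum fun k _ => Finset.sum_le_sum fun g _ => ?_
    refine mul_le_mul_of_nonneg_left ?_ (M.executionWeight_nonneg alg s₁ k g)
    rw [EpisodicMDP.relEnt_outcomeWeight (hardMDP_r_congr _ _) (hardMDP_P_ne_zero _ _)]
    refine Finset.sum_le_sum fun π _ => mul_le_mul_of_nonneg_left ?_ ENNReal.toReal_nonneg
    exact relEnt_hardMDP_le hH θ x hx p π (s₁ k)
  refine (Finset.sum_le_sum step).trans ?_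
  -- The weights belong to the reference instance and do not depend on `p`, so the sum over `p` can
  -- be moved inside, where each policy hits at most one arm.
  rw [Finset.sum_comm]
  calc _ ≤ ∑ k ∈ Finset.range T, C := ?_
    _ = _ := by simp
  refine Finset.sum_le_sum fun k _ => ?_
  rw [Finset.sum_comm]
  calc _ ≤ ∑ g, M.executionWeight alg s₁ k g * C := ?_
    _ = C := by rw [← Finset.sum_mul, M.sum_executionWeight, one_mul]
  refine Finset.sum_le_sum fun g _ => ?_
  rw [← Finset.mul_sum]
  refine mul_le_mul_of_nonneg_left ?_ (M.executionWeight_nonneg alg s₁ k g)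
  rw [Finset.sum_comm]
  calc _ ≤ ∑ π, (alg k (fun i => M.observe (g i)) (s₁ k) π).toReal * C := ?_
    _ = C := by rw [← Finset.sum_mul, sum_toReal_pmf, one_mul]
  refine Finset.sum_le_sum fun π _ => ?_
  rw [← Finset.mul_sum, ← Finset.mul_sum]
  refine mul_le_mul_of_nonneg_left ?_ ENNReal.toReal_nonneg
  exact mul_le_of_le_one_right hC0 (sum_hits_le_one π x arms harms)

open Classical in
/-- Whatever the algorithm does, it rarely finds the distinguished pair of a leaf. -/
theorem sum_hits_executionWeight_le (hH : 0 < H) (alg : Algorithm S A H) (s₁ : ℕ → Fin S)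
    (θ : Fin S → ℕ × ℕ) (x : Fin S) (hx : x ∈ leaves S) (arms : Finset (ℕ × ℕ))
    (harms : ∀ p ∈ arms, p.2 ≠ 0) {T : ℕ} (k : Fin T) :
    ∑ p ∈ arms, ∑ g,
        (hardMDP A H hS h0 h1 m (Function.update θ x p)).executionWeight alg s₁ T g *
          (if (g k).1.Hits 1 x p then 1 else 0)
      ≤ 2 * (T * (((S : ℝ) - 2)⁻¹ * (4 * δ ^ 2)) + 1) := by
  set M := hardMDP A H hS h0 h1 m (Function.update θ x (0, 0)) with hM
  have step : ∀ p ∈ arms, ∑ g,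
        (hardMDP A H hS h0 h1 m (Function.update θ x p)).executionWeight alg s₁ T g *
          (if (g k).1.Hits 1 x p then 1 else 0)
      ≤ 2 * (relEnt (M.executionWeight alg s₁ T)
          ((hardMDP A H hS h0 h1 m (Function.update θ x p)).executionWeight alg s₁ T) +
        ∑ g, M.executionWeight alg s₁ T g * (if (g k).1.Hits 1 x p then 1 else 0)) := by
    intro p _
    have := sum_filter_le_relEnt (M.executionWeight_nonneg alg s₁ T)
      ((hardMDP A H hS h0 h1 m (Function.update θ x p)).executionWeight_nonneg alg s₁ T)
      (M.sum_executionWeight alg s₁ T)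
      ((hardMDP A H hS h0 h1 m (Function.update θ x p)).sum_executionWeight alg s₁ T)
      (histWeight_ne_zero
        (EpisodicMDP.outcomeWeight_ne_zero (hardMDP_r_congr _ _) (hardMDP_P_ne_zero _ _) alg s₁) T)
      (fun g => (g k).1.Hits 1 x p)
    simpa only [mul_ite, mul_one, mul_zero, Finset.sum_filter] using this
  refine (Finset.sum_le_sum step).trans ?_
  rw [← Finset.mul_sum, Finset.sum_add_distrib]
  have e1 := sum_relEnt_executionWeight_le (hS := hS) (h0 := h0) (h1 := h1) (m := m)
    hH alg s₁ θ x hx arms harms T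
  have e2 : ∑ p ∈ arms, ∑ g, M.executionWeight alg s₁ T g *
      (if (g k).1.Hits 1 x p then 1 else 0) ≤ 1 := by
    rw [Finset.sum_comm]
    refine le_trans ?_ (M.sum_executionWeight alg s₁ T).le
    refine Finset.sum_le_sum fun g _ => ?_
    rw [← Finset.mul_sum]
    exact mul_le_of_le_one_right (M.executionWeight_nonneg alg s₁ T g)
      (sum_hits_le_one _ x arms harms)
  linarith

theorem hitFraction_nonneg (hS : 2 < S) (π : Policy S A H) (θ : Fin S → ℕ × ℕ) :
    0 ≤ hitFraction π θ := by
  have hS' : (2 : ℝ) < S := by exact_mod_cast hS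
  exact mul_nonneg (inv_nonneg.2 (by linarith))
    (Finset.sum_nonneg fun s _ => by split_ifs <;> simp)

open Classical in
/-- Some hard instance lets the algorithm find only few of the distinguished pairs. -/
theorem exists_sum_hitFraction_le (hH : 0 < H) (alg : Algorithm S A H) (s₁ : ℕ → Fin S)
    (arms : Finset (ℕ × ℕ)) (harms : ∀ p ∈ arms, p.2 ≠ 0) (hne : arms.Nonempty) (T : ℕ) :
    ∃ θ ∈ Fintype.piFinset fun _ : Fin S => arms,
      ∑ k : Fin T, ∑ g, (hardMDP A H hS h0 h1 m θ).executionWeight alg s₁ T g *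
          hitFraction (g k).1 θ
        ≤ T * (2 * (T * (((S : ℝ) - 2)⁻¹ * (4 * δ ^ 2)) + 1) / arms.card) := by
  have hS' : (2 : ℝ) < S := by exact_mod_cast hS
  have hcard : (0 : ℝ) < arms.card := by exact_mod_cast hne.card_pos
  set Q : ℝ := 2 * (T * (((S : ℝ) - 2)⁻¹ * (4 * δ ^ 2)) + 1) with hQ
  -- It suffices to bound the average over uniformly distributed `θ`. For each leaf the coordinate
  -- `θ x` is resampled, so that the other coordinates are fixed while the arm of `x` varies.
  refine Finset.exists_le_of_sum_le (Fintype.piFinset_nonempty.2 fun _ => hne) ?_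
  have one : ∀ (k : Fin T), ∀ x ∈ leaves S,
      ∑ θ ∈ Fintype.piFinset fun _ : Fin S => arms,
        ∑ g, (hardMDP A H hS h0 h1 m θ).executionWeight alg s₁ T g *
          (if (g k).1.Hits 1 x (θ x) then 1 else 0)
      ≤ (Fintype.piFinset fun _ : Fin S => arms).card * (Q / arms.card) := by
    intro k x hx
    have e := sum_piFinset_update arms x fun θ =>
      ∑ g, (hardMDP A H hS h0 h1 m θ).executionWeight alg s₁ T g *
          (if (g k).1.Hits 1 x (θ x) then 1 else 0)
    have e2 : ∑ θ ∈ Fintype.piFinset fun _ : Fin S => arms, ∑ p ∈ arms,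
        ∑ g, (hardMDP A H hS h0 h1 m (Function.update θ x p)).executionWeight alg s₁ T g *
          (if (g k).1.Hits 1 x (Function.update θ x p x) then 1 else 0)
        ≤ ∑ θ ∈ Fintype.piFinset fun _ : Fin S => arms, Q := by
      refine Finset.sum_le_sum fun θ _ => ?_
      simp only [Function.update_self]
      exact sum_hits_executionWeight_le hH alg s₁ θ x hx arms harms k
    rw [e, Finset.sum_const, nsmul_eq_mul] at e2
    rw [mul_div_assoc', le_div_iff₀ hcard]
    linarith
  have two : ∀ k : Fin T, ∑ θ ∈ Fintype.piFinset fun _ : Fin S => arms,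
      ∑ g, (hardMDP A H hS h0 h1 m θ).executionWeight alg s₁ T g * hitFraction (g k).1 θ
      ≤ (Fintype.piFinset fun _ : Fin S => arms).card * (Q / arms.card) := by
    intro k
    have e : ∀ θ : Fin S → ℕ × ℕ,
        ∑ g, (hardMDP A H hS h0 h1 m θ).executionWeight alg s₁ T g * hitFraction (g k).1 θ
        = ((S : ℝ) - 2)⁻¹ * ∑ x ∈ leaves S,
          ∑ g, (hardMDP A H hS h0 h1 m θ).executionWeight alg s₁ T g *
            (if (g k).1.Hits 1 x (θ x) then 1 else 0) := by
      intro θ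
      rw [Finset.sum_comm, Finset.mul_sum]
      refine Finset.sum_congr rfl fun g _ => ?_
      rw [hitFraction, ← Finset.mul_sum]
      ring
    rw [Finset.sum_congr rfl fun θ _ => e θ, ← Finset.mul_sum, Finset.sum_comm]
    refine (mul_le_mul_of_nonneg_left (Finset.sum_le_sum (one k))
      (inv_nonneg.2 (by linarith))).trans (le_of_eq ?_)
    rw [Finset.sum_const, nsmul_eq_mul, card_leaves hS, inv_mul_cancel_left₀ (by linarith)]
  rw [Finset.sum_comm]
  refine (Finset.sum_le_sum fun k _ => two k).trans (le_of_eq ?_)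
  simp only [Finset.sum_const, Finset.card_univ, Fintype.card_fin, nsmul_eq_mul]
  ring

open Classical in
/-- If the distinguished pairs are found in few leaves on average, then with probability at least
`1 / 2` half of the episodes miss many leaves. -/
theorem half_le_sum_executionWeight (M : EpisodicMDP S A H) (hS : 2 < S) (alg : Algorithm S A H)
    (s₁ : ℕ → Fin S) (θ : Fin S → ℕ × ℕ) {N : ℕ} (hN : 0 < N)
    (h : ∑ k : Fin (2 * N), ∑ g, M.executionWeight alg s₁ (2 * N) g * hitFraction (g k).1 θ
      ≤ (2 * N : ℕ) * (3 / 16)) :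
    1 / 2 ≤ ∑ g with N ≤ (Finset.univ.filter fun k : Fin (2 * N) =>
        hitFraction (g k).1 θ < 3 / 4).card, M.executionWeight alg s₁ (2 * N) g := by
  have hN' : (0 : ℝ) < N := by exact_mod_cast hN
  -- Markov's inequality: on the complement more than `N` of the `2 N` episodes have fraction at
  -- least `3 / 4`, so its probability is at most `(2 N · 3 / 16) / (3 N / 4) = 1 / 2`.
  have hbad : ∑ g with ¬ N ≤ (Finset.univ.filter fun k : Fin (2 * N) =>
        hitFraction (g k).1 θ < 3 / 4).card, M.executionWeight alg s₁ (2 * N) g * (3 / 4 * N)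
      ≤ (2 * N : ℕ) * (3 / 16) := by
    refine le_trans ?_ h
    rw [Finset.sum_comm]
    refine (Finset.sum_le_sum fun g hg => ?_).trans
      (Finset.sum_le_sum_of_subset_of_nonneg (Finset.filter_subset _ _) fun g _ _ =>
        Finset.sum_nonneg fun k _ => mul_nonneg (M.executionWeight_nonneg alg s₁ _ g)
          (hitFraction_nonneg hS _ _))
    rw [← Finset.mul_sum]
    refine mul_le_mul_of_nonneg_left ?_ (M.executionWeight_nonneg alg s₁ _ g)
    have hg' := (Finset.mem_filter.1 hg).2
    have hsplit := Finset.card_filter_add_card_filter_not (s := Finset.univ)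
      (fun k : Fin (2 * N) => hitFraction (g k).1 θ < 3 / 4)
    rw [Finset.card_univ, Fintype.card_fin] at hsplit
    have hc : N ≤ (Finset.univ.filter fun k : Fin (2 * N) =>
        ¬ hitFraction (g k).1 θ < 3 / 4).card := by omega
    have hc' : (N : ℝ) ≤ (Finset.univ.filter fun k : Fin (2 * N) =>
        ¬ hitFraction (g k).1 θ < 3 / 4).card := by exact_mod_cast hc
    calc (3 / 4 * N : ℝ) ≤ ∑ k with ¬ hitFraction (g k).1 θ < 3 / 4, (3 / 4 : ℝ) := by
          rw [Finset.sum_const, nsmul_eq_mul]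
          linarith
      _ ≤ ∑ k with ¬ hitFraction (g k).1 θ < 3 / 4, hitFraction (g k).1 θ :=
          Finset.sum_le_sum fun k hk => not_lt.1 (Finset.mem_filter.1 hk).2
      _ ≤ _ := Finset.sum_le_sum_of_subset_of_nonneg (Finset.filter_subset _ _)
          fun k _ _ => hitFraction_nonneg hS _ _
  rw [← Finset.sum_mul] at hbad
  have htot := Finset.sum_filter_add_sum_filter_not Finset.univ
    (fun g : Fin (2 * N) → Outcome S A H => N ≤ (Finset.univ.filter fun k : Fin (2 * N) =>
        hitFraction (g k).1 θ < 3 / 4).card) (M.executionWeight alg s₁ (2 * N))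
  rw [M.sum_executionWeight] at htot
  push_cast at hbad
  have : ∑ g with ¬ N ≤ (Finset.univ.filter fun k : Fin (2 * N) =>
        hitFraction (g k).1 θ < 3 / 4).card, M.executionWeight alg s₁ (2 * N) g ≤ 1 / 2 := by
    nlinarith
  linarith

/-- The lower bound in terms of the parameters of the hard instance. -/
theorem exists_half_le_executionLaw (hS : 2 < S) (h0 : 0 ≤ δ) (h1 : δ ≤ 1 / 4) (hm : m < H)
    (hm0 : 0 < m) (hA : 1 < A) {ε : ℝ} (hε : 0 < ε) (hδ : ((H : ℝ) - m - 1) * δ = 4 * ε)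
    {N : ℕ} (hN : 0 < N)
    (hb : 2 * ((2 * N : ℕ) * (((S : ℝ) - 2)⁻¹ * (4 * δ ^ 2)) + 1) / (m * (A - 1) : ℕ)
      ≤ (3 / 16 : ℝ))
    (alg : Algorithm S A H) (s₁ : ℕ → Fin S) :
    ∃ M : EpisodicMDP S A H, (1 / 2 : ℝ≥0∞) ≤ M.executionLaw alg s₁
      {ω | (N : ℕ∞) ≤ (M.suboptimalEpisodes s₁ ε ω).encard} := by
  classical
  -- Times start at `1`, when the leaf is reached, and end at `m`, so that every arm leads to the
  -- good state before it pays. Action `0` is reserved for waiting.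
  set arms : Finset (ℕ × ℕ) := Finset.Icc 1 m ×ˢ Finset.Icc 1 (A - 1) with harms
  have hcard : arms.card = m * (A - 1) := by
    rw [harms, Finset.card_product, Nat.card_Icc, Nat.card_Icc]
    simp
  have hmem : ∀ p ∈ arms, 1 ≤ p.1 ∧ p.1 ≤ m ∧ 1 ≤ p.2 ∧ p.2 < A := by
    intro p hp
    simp only [harms, Finset.mem_product, Finset.mem_Icc] at hp
    omega
  have hne : arms.Nonempty :=
    ⟨(1, 1), by simp only [harms, Finset.mem_product, Finset.mem_Icc]; omega⟩
  obtain ⟨θ, hθ, hsum⟩ := exists_sum_hitFraction_le (hS := hS) (h0 := h0) (h1 := h1) (m := m)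
    (by omega : 0 < H) alg s₁ arms (fun p hp => by have := hmem p hp; omega) hne (2 * N)
  rw [Fintype.mem_piFinset] at hθ
  have hsum' := hsum.trans (mul_le_mul_of_nonneg_left (hcard ▸ hb) (Nat.cast_nonneg _))
  have hhalf := half_le_sum_executionWeight (hardMDP A H hS h0 h1 m θ) hS alg s₁ θ hN hsum'
  refine ⟨hardMDP A H hS h0 h1 m θ, ?_⟩
  calc (1 / 2 : ℝ≥0∞) = ENNReal.ofReal (1 / 2) := by
        rw [ENNReal.ofReal_div_of_pos two_pos]
        simp
    _ ≤ _ := ENNReal.ofReal_le_ofReal hhalf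
    _ ≤ _ := EpisodicMDP.le_executionLaw _ alg s₁ (by omega) _ _ fun ω hω => ?_
  have hsub : (((Finset.univ.filter fun k : Fin (2 * N) =>
      hitFraction (ω k).1 θ < 3 / 4).map Fin.valEmbedding : Finset ℕ) : Set ℕ)
      ⊆ (hardMDP A H hS h0 h1 m θ).suboptimalEpisodes s₁ ε ω := by
    intro k hk
    simp only [Finset.coe_map, Set.mem_image, Finset.mem_coe, Finset.mem_filter,
      Finset.mem_univ, true_and, Fin.valEmbedding_apply] at hk
    obtain ⟨k, hk, rfl⟩ := hk
    have := hardMDP_suboptimality (hS := hS) (h0 := h0) (h1 := h1) hm θ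
      (fun s => hmem _ (hθ s)) (ω k).1 (s₁ k)
    rw [hδ] at this
    change ε < _
    -- The gap is at least `4 ε (1 - f)` with `f < 3 / 4`, hence above `ε`.
    nlinarith
  refine le_trans ?_ (Set.encard_le_encard hsub)
  rw [Set.encard_coe_eq_coe_finsetCard, Finset.card_map]
  exact_mod_cast hω

end lowerBound

end EpisodicRL
-- Choice of the constants
theorem theorem3 :
    ∃ c : ℝ, 0 < c ∧ ∃ n₀ : ℕ, ∀ S A H : ℕ, n₀ < S → n₀ < A → n₀ < H →
      ∀ ε : ℝ, 0 < ε → ε ≤ 8 / (H : ℝ) →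
        ∀ (alg : EpisodicRL.Algorithm S A H) (s₁ : ℕ → Fin S),
          ∃ M : EpisodicRL.EpisodicMDP S A H,
            (1 / 2 : ℝ≥0∞) ≤ M.executionLaw alg s₁
              {ω | (⌈c * ((S : ℝ) * (A : ℝ) * (H : ℝ) ^ 3 / ε ^ 2)⌉₊ : ℕ∞)
                ≤ (M.suboptimalEpisodes s₁ ε ω).encard} := by
  refine ⟨1 / 2 ^ 20, by positivity, 32, fun S A H hS hA hH ε hε hεH alg s₁ => ?_⟩
  set m := H / 2 with hm
  have hS' : (33 : ℝ) ≤ S := by exact_mod_cast hS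
  have hA' : (33 : ℝ) ≤ A := by exact_mod_cast hA
  have hH' : (33 : ℝ) ≤ H := by exact_mod_cast hH
  have hm4 : (H : ℝ) ≤ 4 * m := by
    have : H ≤ 4 * m := by omega
    exact_mod_cast this
  have hR4 : (H : ℝ) / 4 ≤ (H : ℝ) - m - 1 := by
    have : H + 4 * m + 4 ≤ 4 * H := by omega
    have : (H : ℝ) + 4 * m + 4 ≤ 4 * H := by exact_mod_cast this
    linarith
  -- With `m = H / 2` both the number of exit times and the reward `R` of the good state are at
  -- least `H / 4`. The advantage is `δ = 4 ε / R ≤ 16 ε / H`.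
  set R : ℝ := (H : ℝ) - m - 1 with hR
  have hR0 : 0 < R := by linarith
  have hεH' : ε * H ≤ 8 := (le_div_iff₀ (by linarith)).1 hεH
  have hδε : 4 * ε / R ≤ 16 * ε / H := by
    rw [div_le_div_iff₀ hR0 (by linarith)]
    nlinarith
  have hδ1 : 4 * ε / R ≤ 1 / 4 := by
    refine hδε.trans ?_
    rw [div_le_div_iff₀ (by linarith) (by norm_num)]
    nlinarith
  have hδ0 : 0 ≤ 4 * ε / R := by positivity
  set X : ℝ := (S : ℝ) * (A : ℝ) * (H : ℝ) ^ 3 / ε ^ 2 with hX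
  have hX1 : 2 ^ 20 ≤ X := by
    rw [hX, le_div_iff₀ (by positivity)]
    have e1 : ε ≤ 1 := by nlinarith
    have e2 : ε ^ 2 ≤ 1 / 16 := by
      have : ε ≤ 1 / 4 := by nlinarith
      nlinarith
    have e3 : (33 : ℝ) ^ 3 ≤ (H : ℝ) ^ 3 := by gcongr
    have e4 : (33 : ℝ) * 33 * 33 ^ 3 ≤ (S : ℝ) * A * H ^ 3 := by gcongr
    nlinarith
  set N : ℕ := ⌈1 / 2 ^ 20 * X⌉₊ with hN
  have hN0 : 0 < N := Nat.ceil_pos.2 (by positivity)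
  -- As `X / 2 ^ 20 ≥ 1`, rounding up costs at most a factor `2`.
  have hN2 : (N : ℝ) ≤ 2 * (1 / 2 ^ 20 * X) := by
    have e1 : (N : ℝ) < 1 / 2 ^ 20 * X + 1 := Nat.ceil_lt_add_one (by positivity)
    have e2 : (1 : ℝ) ≤ 1 / 2 ^ 20 * X := by
      rw [div_mul_eq_mul_div, one_mul, le_div_iff₀ (by positivity)]
      linarith
    linarith
  refine EpisodicRL.exists_half_le_executionLaw (m := m) (by omega) hδ0 hδ1 (by omega) (by omega)
    (by omega) hε (by rw [← hR]; field_simp) hN0 ?_ alg s₁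
  have hAm : ((m * (A - 1) : ℕ) : ℝ) = m * (A - 1) := by
    rw [Nat.cast_mul, Nat.cast_sub (by omega), Nat.cast_one]
  have hn : (H : ℝ) * A / 8 ≤ m * (A - 1) := by nlinarith
  have hδsq : (4 * ε / R) ^ 2 ≤ 256 * ε ^ 2 / H ^ 2 := by
    calc (4 * ε / R) ^ 2 ≤ (16 * ε / H) ^ 2 := by gcongr
      _ = _ := by ring
  have hL : ((S : ℝ) - 2)⁻¹ ≤ 2 / S := by
    rw [inv_eq_one_div, div_le_div_iff₀ (by linarith) (by linarith)]
    linarith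
  -- The constant `2 ^ 20` enters here: the numerical factors multiply to `2 ^ 13`, leaving `H A / 2
  -- ^ 7`. Against at least `H A / 8` arms, the averaged hit probability is at most `1 / 8 + 16 / (H
  -- A) ≤ 3 / 16`.
  have hT : ((2 * N : ℕ) : ℝ) * (((S : ℝ) - 2)⁻¹ * (4 * (4 * ε / R) ^ 2)) ≤ (H : ℝ) * A / 128 := by
    push_cast
    calc (2 : ℝ) * N * (((S : ℝ) - 2)⁻¹ * (4 * (4 * ε / R) ^ 2))
        ≤ (2 * (2 * (1 / 2 ^ 20 * X))) * (2 / S * (4 * (256 * ε ^ 2 / H ^ 2))) := by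
          have : 0 ≤ ((S : ℝ) - 2)⁻¹ := inv_nonneg.2 (by linarith)
          gcongr
      _ = (H : ℝ) * A / 128 := by
          rw [hX]
          field_simp
          norm_num
  rw [hAm, div_le_iff₀ (by nlinarith)]
  nlinarith
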